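/- Let $d\ge 0$ and let $H_\omega=-\Delta+\lambda V_\omega$ be the random Schr\"odinger operator on $\ell^2(\mathbb Z^d)$, where $(-\Delta\psi)(x)=\sum_{|y-x|=1}(\psi(x)-\psi(y))$, $\lambda>0$, and the values $V_\omega(x)$, $x\in\mathbb Z^d$, are independent real random variables with a common law $\nu$ that has a bounded density with compact support. For $\Omega\subset\mathbb Z^d$ let $H_{\Omega;\omega}$ be the restriction of $H_\omega$ to $\ell^2(\Omega)$; the matrix element $\langle x|(H_{\Omega;\omega}-z)^{-1}|y\rangle$ is read as $0$ unless $x,y\in\Omega$. For a finite $\Lambda\subset\mathbb Z^d$ let $\Lambda^+$ be the union of $\Lambda$ with the set of all nearest neighbours of its sites, and let $\Gamma(\Lambda)$ be the set of nearest-neighbour bonds $\langle u,u'\rangle$ with $u\in\Lambda$, $u'\notin\Lambda$. Write $|x-y|=\sum_j|x_j-y_j|$, and $$\mathbb E_{\pm i0}\big(|\langle x|(H_{\Omega;\omega}-E)^{-1}|y\rangle|^s\big)=\lim_{\eta\to0^{\pm}}\mathbb E\big(|\langle x|(H_{\Omega;\omega}-E-i\eta)^{-1}|y\rangle|^s\big).$$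 Theorem. For every $s\in(0,1)$ there is a constant $\widetilde C_s>0$ (depending on $s$, $d$ and $\nu$ only) such that, for every $\lambda>0$ and every finite $\Lambda\subset\mathbb Z^d$ that contains the origin, the following holds. For $E\in\mathbb C$ (in particular $E\in\mathbb R$) put $$b(E)=\max_{W\subset\Lambda}\Big\{|\Gamma(\Lambda^+)|\,\frac{\widetilde C_s}{\lambda^s}\sum_{\langle u,u'\rangle\in\Gamma(\Lambda)}\mathbb E\big(|\langle 0|(H_{W;\omega}-E)^{-1}|u\rangle|^s\big)\Big\}.$$ If $b(E)<1$, then there are $\mu>0$ and $A<\infty$, which depend on $E$ only through the value $b(E)$, such that for every region $\Omega\subset\mathbb Z^d$, finite or infinite, and all $x,y\in\Omega$ both limits $\mathbb E_{\pm i0}$ exist and $$\mathbb E_{\pm i0}\big(|\langle x|(H_{\Omega;\omega}-E)^{-1}|y\rangle|^s\big)\le A\,e^{-\mu|x-y|}.$$ -/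

import Mathlib

open MeasureTheory ProbabilityTheory Filter Topology
open scoped ENNReal

noncomputable section

namespace Anderson

/-- Sites of the lattice `ℤ^d`. -/
abbrev Site (d : ℕ) := Fin d → ℤ

/-- The unit lattice vector in direction `i`. -/
def unitVec {d : ℕ} (i : Fin d) : Site d := Pi.single i 1

/-- The distance `∑ |x_i - y_i|` on `ℤ^d`. -/
def siteDist {d : ℕ} (x y : Site d) : ℝ := ∑ i, |(x i : ℝ) - (y i : ℝ)|

/-- The `2 d` nearest neighbours of a site. -/
def nbrs {d : ℕ} (x : Site d) : Finset (Site d) :=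
  (Finset.univ.image fun i => x + unitVec i) ∪ (Finset.univ.image fun i => x - unitVec i)

/-- `Λ⁺`: the region obtained from `Λ` by adding all nearest neighbours of its sites. -/
def fatten {d : ℕ} (Λ : Finset (Site d)) : Finset (Site d) := Λ ∪ Λ.biUnion nbrs

/-- `Γ(Λ)`: the lattice bonds that connect a site of `Λ` with a site outside `Λ`.  A bond is
recorded as the pair `(u, u')` with `u ∈ Λ` and `u' ∉ Λ`. -/
def boundaryBonds {d : ℕ} (Λ : Finset (Site d)) : Finset (Site d × Site d) :=
  (Λ ×ˢ fatten Λ).filter fun p => p.2 ∈ nbrs p.1 ∧ p.2 ∉ Λ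

/-- The Hilbert space `ℓ²(Ω)` of a region `Ω ⊆ ℤ^d`. -/
abbrev L2 {d : ℕ} (Ω : Set (Site d)) := lp (fun _ : Ω => ℂ) 2

open Classical in
/-- Extension of a function on `Ω` by zero to `ℤ^d`. -/
def zeroExt {d : ℕ} {Ω : Set (Site d)} (ψ : Ω → ℂ) (x : Site d) : ℂ :=
  if h : x ∈ Ω then ψ ⟨x, h⟩ else 0

/-- The action of the restriction to `Ω` of `-Δ + lam V`, where
`(-Δ ψ)(x) = ∑_{|y - x| = 1} (ψ(x) - ψ(y))`. -/
def hamFun {d : ℕ} (lam : ℝ) (V : Site d → ℝ) (Ω : Set (Site d)) (ψ : Ω → ℂ) (x : Ω) : ℂ :=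
  (∑ i, (2 * ψ x - zeroExt ψ (x.1 + unitVec i) - zeroExt ψ (x.1 - unitVec i)))
    + ((lam * V x.1 : ℝ) : ℂ) * ψ x

/-- The potential is bounded on `Ω`. -/
def BoundedOn {d : ℕ} (V : Site d → ℝ) (Ω : Set (Site d)) : Prop :=
  ∃ M : ℝ, ∀ x ∈ Ω, |V x| ≤ M

theorem memℓp_zeroExt_comp {d : ℕ} {Ω : Set (Site d)} {ψ : Ω → ℂ} (hψ : Memℓp ψ 2)
    {f : Ω → Site d} (hf : Function.Injective f) : Memℓp (fun x => zeroExt ψ (f x)) 2 := by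
  have h2 : 0 < (2 : ℝ≥0∞).toReal := by norm_num
  rw [memℓp_gen_iff h2] at hψ ⊢
  have h : Summable fun x : Site d => ‖zeroExt ψ x‖ ^ (2 : ℝ≥0∞).toReal := by
    refine (Function.Injective.summable_iff (Subtype.val_injective (p := (· ∈ Ω))) ?_).1 ?_
    · intro x hx
      have hx' : x ∉ Ω := by simpa using hx
      simp [zeroExt, hx']
    · convert hψ using 2 with x
      simp [zeroExt]
  exact h.comp_injective hf

theorem memℓp_hamFun {d : ℕ} (lam : ℝ) {V : Site d → ℝ} {Ω : Set (Site d)}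
    (hV : BoundedOn V Ω) {ψ : Ω → ℂ} (hψ : Memℓp ψ 2) : Memℓp (hamFun lam V Ω ψ) 2 := by
  obtain ⟨M, hM⟩ := hV
  have h1 : ∀ i : Fin d, Memℓp (fun x : Ω => 2 * ψ x - zeroExt ψ (x.1 + unitVec i)
      - zeroExt ψ (x.1 - unitVec i)) 2 := fun i =>
    ((hψ.const_mul 2).sub (memℓp_zeroExt_comp hψ fun a b h => Subtype.ext (by simpa using h))).sub
      (memℓp_zeroExt_comp hψ fun a b h => Subtype.ext (by simpa using h))
  have h2 : Memℓp (fun x : Ω => ((lam * V x.1 : ℝ) : ℂ) * ψ x) 2 := by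
    have h2 : 0 < (2 : ℝ≥0∞).toReal := by norm_num
    have h3 := hψ.const_mul ((|lam| * M : ℝ) : ℂ)
    rw [memℓp_gen_iff h2] at h3 ⊢
    refine Summable.of_nonneg_of_le (fun x => by positivity) (fun x => ?_) h3
    have hx := hM x.1 x.2
    have hM0 : 0 ≤ M := (abs_nonneg _).trans hx
    refine Real.rpow_le_rpow (norm_nonneg _) ?_ h2.le
    simp only [norm_mul, Complex.norm_real, Real.norm_eq_abs, abs_abs, abs_of_nonneg hM0]
    gcongr
  have h4 := (Memℓp.finsetSum Finset.univ fun i _ => h1 i).add h2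
  exact h4

/-- The restriction of `-Δ + lam V` to `ℓ²(Ω)`, for a potential bounded on `Ω`, as a linear map. -/
def hamLin {d : ℕ} (lam : ℝ) {V : Site d → ℝ} {Ω : Set (Site d)} (hV : BoundedOn V Ω) :
    L2 Ω →ₗ[ℂ] L2 Ω where
  toFun ψ := ⟨hamFun lam V Ω ψ, memℓp_hamFun lam hV ψ.2⟩
  map_add' ψ φ := by
    ext x
    have h : ∀ a : Site d, zeroExt (⇑(ψ + φ)) a = zeroExt (⇑ψ) a + zeroExt (⇑φ) a := fun a => by
      by_cases ha : a ∈ Ω <;> simp [zeroExt, ha]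
    simp only [hamFun, h]
    simp only [hamFun, lp.coeFn_add, Pi.add_apply]
    rw [add_add_add_comm, ← Finset.sum_add_distrib, ← mul_add]
    congr 1
    exact Finset.sum_congr rfl fun i _ => by ring
  map_smul' c ψ := by
    ext x
    have h : ∀ a : Site d, zeroExt (⇑(c • ψ)) a = c * zeroExt (⇑ψ) a := fun a => by
      by_cases ha : a ∈ Ω <;> simp [zeroExt, ha]
    simp only [hamFun, h]
    simp only [hamFun, lp.coeFn_smul, Pi.smul_apply, smul_eq_mul, RingHom.id_apply]
    rw [mul_add, Finset.mul_sum]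
    congr 1
    · exact Finset.sum_congr rfl fun i _ => by ring
    · ring

theorem isClosed_graph_hamLin {d : ℕ} (lam : ℝ) {V : Site d → ℝ} {Ω : Set (Site d)}
    (hV : BoundedOn V Ω) : IsClosed ((hamLin lam hV).graph : Set (L2 Ω × L2 Ω)) := by
  have hz : ∀ a : Site d, Continuous fun ψ : L2 Ω => zeroExt (⇑ψ) a := fun a => by
    by_cases ha : a ∈ Ω
    · simp only [zeroExt, ha, dif_pos]
      exact (lp.evalCLM ℂ (fun _ : Ω => ℂ) 2 ⟨a, ha⟩).continuous
    · simpa [zeroExt, ha] using continuous_const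
  have he : ∀ x : Ω, Continuous fun ψ : L2 Ω => ψ x := fun x =>
    (lp.evalCLM ℂ (fun _ : Ω => ℂ) 2 x).continuous
  have hf : ∀ x : Ω, Continuous fun ψ : L2 Ω => hamFun lam V Ω ψ x := fun x => by
    unfold hamFun
    exact (continuous_finsetSum _ fun i _ =>
      ((continuous_const.mul (he x)).sub (hz _)).sub (hz _)).add (continuous_const.mul (he x))
  have hset : ((hamLin lam hV).graph : Set (L2 Ω × L2 Ω))
      = ⋂ x : Ω, {p : L2 Ω × L2 Ω | p.2 x = hamFun lam V Ω p.1 x} := by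
    ext p
    simp only [SetLike.mem_coe, LinearMap.mem_graph_iff, Set.mem_iInter, Set.mem_ofPred_eq]
    constructor
    · intro h x
      rw [h]
      rfl
    · intro h
      ext x
      exact h x
  rw [hset]
  exact isClosed_iInter fun x =>
    isClosed_eq ((he x).comp continuous_snd) ((hf x).comp continuous_fst)

open Classical in
/-- The bounded operator `H_Ω` on `ℓ²(Ω)`, the restriction of `-Δ + lam V` to `Ω`.  When `V` is
unbounded on `Ω` (for i.i.d. potentials with compactly supported law this event has
probability zero) the value is `0`. -/
def ham {d : ℕ} (lam : ℝ) (V : Site d → ℝ) (Ω : Set (Site d)) : L2 Ω →L[ℂ] L2 Ω :=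
  if hV : BoundedOn V Ω then
    ContinuousLinearMap.ofIsClosedGraph (isClosed_graph_hamLin lam hV)
  else 0

theorem ham_apply {d : ℕ} (lam : ℝ) {V : Site d → ℝ} {Ω : Set (Site d)} (hV : BoundedOn V Ω)
    (ψ : L2 Ω) (x : Ω) : ham lam V Ω ψ x = hamFun lam V Ω ψ x := by
  simp [ham, hV, hamLin]

open Classical in
/-- The Green function `⟨x| (H_Ω - z)⁻¹ |y⟩`, which is `0` unless `x` and `y` both lie in `Ω`. -/
def green {d : ℕ} (lam : ℝ) (V : Site d → ℝ) (Ω : Set (Site d)) (z : ℂ) (x y : Site d) : ℂ :=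
  if h : x ∈ Ω ∧ y ∈ Ω then
    (Ring.inverse (ham lam V Ω - z • (1 : L2 Ω →L[ℂ] L2 Ω)))
      (lp.single 2 (⟨y, h.2⟩ : Ω) (1 : ℂ)) ⟨x, h.1⟩
  else 0

/-- The law `ν` has a bounded density with compact support. -/
def IsRegularLaw (ν : Measure ℝ) : Prop :=
  ∃ ρ : ℝ → ℝ, Measurable ρ ∧ (∀ v, 0 ≤ ρ v) ∧ (∃ M : ℝ, ∀ v, ρ v ≤ M) ∧ HasCompactSupport ρ ∧
    ν = volume.withDensity fun v => ENNReal.ofReal (ρ v)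

/-- The site potentials `V x` are independent random variables with common law `ν`. -/
structure IsIIDPotential {d : ℕ} {S : Type*} [MeasurableSpace S] (P : Measure S)
    (V : Site d → S → ℝ) (ν : Measure ℝ) : Prop where
  measurable : ∀ x, Measurable (V x)
  map_eq : ∀ x, P.map (V x) = ν
  indep : iIndepFun V P

/-- The fractional moment `E (|⟨x| (H_Ω - z)⁻¹ |y⟩|^s)`, as a number in `[0, ∞]`. -/
def greenMoment {d : ℕ} {S : Type*} [MeasurableSpace S] (P : Measure S) (V : Site d → S → ℝ)
    (lam s : ℝ) (Ω : Set (Site d)) (z : ℂ) (x y : Site d) : ℝ≥0∞ :=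
  ∫⁻ ω, ‖green lam (fun a => V a ω) Ω z x y‖ₑ ^ s ∂P

/-- The quantity
`max_{W ⊆ Λ} |Γ(Λ⁺)| (C / lam^s) ∑_{⟨u,u'⟩ ∈ Γ(Λ)} E (|⟨0| (H_W - E)⁻¹ |u⟩|^s)`. -/
def criterion {d : ℕ} {S : Type*} [MeasurableSpace S] (P : Measure S) (V : Site d → S → ℝ)
    (lam s C : ℝ) (Λ : Finset (Site d)) (E : ℂ) : ℝ≥0∞ :=
  Λ.powerset.sup fun W =>
    ((boundaryBonds (fatten Λ)).card : ℝ≥0∞) * ENNReal.ofReal (C / lam ^ s) *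
      ∑ b ∈ boundaryBonds Λ, greenMoment P V lam s (W : Set (Site d)) E 0 b.1

/-- `E_{± i0}` of the fractional moment at `E`: the limit of the fractional moment at `E + i η`
as `η` tends to `0` along the filter `l` exists and is at most `B`. -/
def LimitMomentLE {d : ℕ} {S : Type*} [MeasurableSpace S] (P : Measure S) (V : Site d → S → ℝ)
    (lam s : ℝ) (Ω : Set (Site d)) (E : ℂ) (x y : Site d) (l : Filter ℝ) (B : ℝ) : Prop :=
  ∃ L : ℝ≥0∞,
    Tendsto (fun η : ℝ => greenMoment P V lam s Ω (E + Complex.I * η) x y) l (𝓝 L) ∧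
      L ≤ ENNReal.ofReal B

end Anderson

end

namespace Anderson

/-! ### The Green function as the solution of a difference equation -/

/-! This is the fractional moment method with a finite-volume criterion. Two facts carry it, both
for finite regions `R` and non-real `z`.

A priori bound (`exists_aprioriBound`): averaging over the potential at `x` and `y` alone gives `E
|G_R(x,y)|^s ≤ K = C / lam^s`, uniformly in `R`, `z` and all other values of the potential. By a
rank-two Krein formula, `G_R(x,y)` is `b / (lam ((v+a)(w+c) - b²))` in the values `v`, `w` at the
two sites. This is dominated by six terms `1/|v-ζ|` or `1/|w-ζ|`, where `ζ` does not depend on the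
variable displayed with it. A bounded density makes the `s`-th power of each integrable for `s < 1`.

Decoupling (`AprioriBound.moment_le_sum`): the geometric resolvent identity, used at the boundary of
`Λ` and again at that of `Λ⁺`, bounds `|G_R(x,y)|` by a sum of products `|G_{R∩Λ}(x,u)| |G_R(u',v)|
|G_{R∖Λ⁺}(v',y)|`. The sites `u'` and `v` lie in `Λ⁺ ∖ Λ`, which neither outer factor sees. So the
middle factor is averaged to at most `K`, and the outer ones are independent. Summing over bonds,
each use of the inequality gains a factor at most `b`, by translation invariance and the maximum
over `W ⊆ Λ`. Iteration gives exponential decay (`AprioriBound.moment_le_pow`,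
`AprioriBound.expDecay`).

It remains to pass to `E` itself and to infinite `Ω`. In finite volume, `E` is almost surely not an
eigenvalue, and moments of an order `r ∈ (s,1)` give uniform integrability. Hence the criterion is
continuous along non-real `z → E` and stays below some `q < 1` near `E`, so the decay is uniform
there. That decay makes the moments in `Ω` and in its cut-offs to boxes close, uniformly in `z` near
`E`. The limits of large boxes and of `z → E` can then be exchanged (`exists_tendsto_moment`). -/

theorem unitVec_injective {d : ℕ} : Function.Injective (unitVec : Fin d → Site d) := by
  intro i j h
  by_contra hij
  have := congrFun h i
  simp [unitVec, hij] at this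

theorem sum_nbrs {d : ℕ} (g : Site d → ℂ) (x : Site d) :
    ∑ u ∈ nbrs x, g u = ∑ i, (g (x + unitVec i) + g (x - unitVec i)) := by
  classical
  rw [nbrs, Finset.sum_union, Finset.sum_image, Finset.sum_image, Finset.sum_add_distrib]
  · intro i _ j _ h
    exact unitVec_injective (by simpa using h)
  · intro i _ j _ h
    exact unitVec_injective (by simpa using h)
  · rw [Finset.disjoint_left]
    intro u hu hv
    simp only [Finset.mem_image, Finset.mem_univ, true_and] at hu hv
    obtain ⟨i, rfl⟩ := hu
    obtain ⟨j, hj⟩ := hv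
    have h : -unitVec j = (unitVec i : Site d) := by
      have : x + -unitVec j = x + unitVec i := by rw [← hj]; abel
      exact add_left_cancel this
    have h' := congrFun h i
    simp only [unitVec, Pi.neg_apply, Pi.single_apply, if_true] at h'
    split_ifs at h'
    all_goals omega

theorem mem_nbrs_iff {d : ℕ} {x u : Site d} :
    u ∈ nbrs x ↔ ∃ i, u = x + unitVec i ∨ u = x - unitVec i := by
  simp only [nbrs, Finset.mem_union, Finset.mem_image, Finset.mem_univ, true_and]
  constructor
  · rintro (⟨i, rfl⟩ | ⟨i, rfl⟩)
    exacts [⟨i, .inl rfl⟩, ⟨i, .inr rfl⟩]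
  · rintro ⟨i, rfl | rfl⟩
    exacts [.inl ⟨i, rfl⟩, .inr ⟨i, rfl⟩]

theorem mem_nbrs_comm {d : ℕ} {x u : Site d} : u ∈ nbrs x ↔ x ∈ nbrs u := by
  simp only [mem_nbrs_iff]
  constructor
  · rintro ⟨i, rfl | rfl⟩
    exacts [⟨i, .inr (by simp)⟩, ⟨i, .inl (by simp)⟩]
  · rintro ⟨i, rfl | rfl⟩
    exacts [⟨i, .inr (by simp)⟩, ⟨i, .inl (by simp)⟩]

theorem mem_nbrs_add {d : ℕ} {x u a : Site d} : u + a ∈ nbrs (x + a) ↔ u ∈ nbrs x := by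
  simp only [mem_nbrs_iff]
  refine exists_congr fun i => ?_
  rw [show x + a + unitVec i = x + unitVec i + a by abel,
    show x + a - unitVec i = x - unitVec i + a by abel]
  simp

/-- The difference operator `-Δ + lam V - z` on functions on `ℤ^d`. -/
noncomputable def diffOp {d : ℕ} (lam : ℝ) (V : Site d → ℝ) (z : ℂ) (g : Site d → ℂ)
    (x : Site d) : ℂ :=
  ((2 * d + lam * V x : ℝ) - z) * g x - ∑ u ∈ nbrs x, g u

theorem diffOp_zeroExt {d : ℕ} {lam : ℝ} {V : Site d → ℝ} {Ω : Set (Site d)} {z : ℂ}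
    (ψ : Ω → ℂ) (x : Ω) :
    diffOp lam V z (zeroExt ψ) x = hamFun lam V Ω ψ x - z * ψ x := by
  have hx : zeroExt ψ x.1 = ψ x := by simp [zeroExt]
  rw [diffOp, sum_nbrs, hamFun, hx]
  simp only [sub_sub, Finset.sum_sub_distrib, Finset.sum_const, Finset.card_univ,
    Fintype.card_fin, nsmul_eq_mul]
  push_cast
  ring

theorem green_eq_zero_left {d : ℕ} {lam : ℝ} {V : Site d → ℝ} {Ω : Set (Site d)} {z : ℂ}
    {x y : Site d} (hx : x ∉ Ω) : green lam V Ω z x y = 0 := by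
  simp [green, hx]

theorem green_eq_zero_right {d : ℕ} {lam : ℝ} {V : Site d → ℝ} {Ω : Set (Site d)} {z : ℂ}
    {x y : Site d} (hy : y ∉ Ω) : green lam V Ω z x y = 0 := by
  simp [green, hy]

/-- `z` is in the resolvent set of `H_Ω`. -/
def Resolvent {d : ℕ} (lam : ℝ) (V : Site d → ℝ) (Ω : Set (Site d)) (z : ℂ) : Prop :=
  IsUnit (ham lam V Ω - z • (1 : L2 Ω →L[ℂ] L2 Ω))

/-- The column `⟨·| (H_Ω - z)⁻¹ |y⟩` as an element of `ℓ²(Ω)`. -/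
noncomputable def greenVec {d : ℕ} (lam : ℝ) (V : Site d → ℝ) (Ω : Set (Site d)) (z : ℂ)
    (y : Ω) : L2 Ω :=
  Ring.inverse (ham lam V Ω - z • (1 : L2 Ω →L[ℂ] L2 Ω)) (lp.single 2 y (1 : ℂ))

theorem green_eq_zeroExt {d : ℕ} (lam : ℝ) (V : Site d → ℝ) (Ω : Set (Site d)) (z : ℂ)
    (y : Ω) : (fun a => green lam V Ω z a y) = zeroExt (greenVec lam V Ω z y) := by
  funext a
  by_cases ha : a ∈ Ω <;> simp [green, zeroExt, greenVec, ha]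

theorem ham_greenVec {d : ℕ} {lam : ℝ} {V : Site d → ℝ} {Ω : Set (Site d)} {z : ℂ}
    (hR : Resolvent lam V Ω z) (y : Ω) :
    ham lam V Ω (greenVec lam V Ω z y) - z • greenVec lam V Ω z y = lp.single 2 y (1 : ℂ) := by
  have h := Ring.mul_inverse_cancel _ hR
  exact congrArg (fun T : L2 Ω →L[ℂ] L2 Ω => T (lp.single 2 y (1 : ℂ))) h

theorem diffOp_green {d : ℕ} {lam : ℝ} {V : Site d → ℝ} {Ω : Set (Site d)} {z : ℂ}
    (hV : BoundedOn V Ω) (hR : Resolvent lam V Ω z) {x y : Site d} (hx : x ∈ Ω) (hy : y ∈ Ω) :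
    diffOp lam V z (fun a => green lam V Ω z a y) x = if x = y then 1 else 0 := by
  have h := congrArg (fun ψ : L2 Ω => ψ ⟨x, hx⟩) (ham_greenVec hR ⟨y, hy⟩)
  have h2 := green_eq_zeroExt lam V Ω z ⟨y, hy⟩
  simp only at h2
  rw [h2]
  have h3 := diffOp_zeroExt (lam := lam) (V := V) (z := z)
    (greenVec lam V Ω z ⟨y, hy⟩ : Ω → ℂ) ⟨x, hx⟩
  simp only at h3
  rw [h3, ← ham_apply lam hV]
  simp only [lp.coeFn_sub, Pi.sub_apply, lp.coeFn_smul, Pi.smul_apply, smul_eq_mul] at h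
  rw [h, lp.coeFn_single, Pi.single_apply]
  simp

theorem boundedOn_finset {d : ℕ} (V : Site d → ℝ) (W : Finset (Site d)) :
    BoundedOn V (W : Set (Site d)) :=
  ⟨∑ x ∈ W, |V x|, fun _ hx =>
    Finset.single_le_sum (f := fun x => |V x|) (fun _ _ => abs_nonneg _) hx⟩

/-- Adjacency is symmetric, and functions vanishing off `W` reduce neighbour sums to `W`. The
pairing is bilinear, without conjugation, so the symmetry survives complex `z`. -/
theorem diffOp_symm {d : ℕ} {lam : ℝ} {V : Site d → ℝ} {z : ℂ} {W : Finset (Site d)}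
    {f g : Site d → ℂ} (hf : ∀ a ∉ W, f a = 0) (hg : ∀ a ∉ W, g a = 0) :
    ∑ u ∈ W, f u * diffOp lam V z g u = ∑ u ∈ W, g u * diffOp lam V z f u := by
  classical
  have key : ∀ f g : Site d → ℂ, (∀ a ∉ W, g a = 0) →
      ∑ u ∈ W, f u * ∑ v ∈ nbrs u, g v = ∑ u ∈ W, ∑ v ∈ W, if v ∈ nbrs u then f u * g v else 0 := by
    intro f g hg
    refine Finset.sum_congr rfl fun u _ => ?_
    rw [Finset.mul_sum, ← Finset.sum_filter]
    symm
    apply Finset.sum_subset_zero_on_sdiff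
    · intro v hv
      exact (Finset.mem_filter.1 hv).2
    · intro v hv
      simp only [Finset.mem_sdiff, Finset.mem_filter, not_and] at hv
      rw [hg v fun h => hv.2 h hv.1, mul_zero]
    · intros; rfl
  simp only [diffOp, mul_sub, Finset.sum_sub_distrib]
  rw [key f g hg, key g f hf, Finset.sum_comm (f := fun u v => if v ∈ nbrs u then g u * f v else 0)]
  congr 1
  · exact Finset.sum_congr rfl fun u _ => by ring
  · refine Finset.sum_congr rfl fun u _ => Finset.sum_congr rfl fun v _ => ?_
    simp only [mem_nbrs_comm (x := u), mul_comm]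

theorem green_symm {d : ℕ} {lam : ℝ} {V : Site d → ℝ} {W : Finset (Site d)} {z : ℂ}
    (hR : Resolvent lam V (W : Set (Site d)) z) (x y : Site d) :
    green lam V (W : Set (Site d)) z x y = green lam V (W : Set (Site d)) z y x := by
  classical
  by_cases hx : x ∈ W
  swap
  · rw [green_eq_zero_left (by simpa), green_eq_zero_right (by simpa)]
  by_cases hy : y ∈ W
  swap
  · rw [green_eq_zero_left (x := y) (by simpa), green_eq_zero_right (y := y) (by simpa)]
  have h := diffOp_symm (lam := lam) (V := V) (z := z) (W := W)
    (f := fun a => green lam V (W : Set (Site d)) z a x)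
    (g := fun a => green lam V (W : Set (Site d)) z a y)
    (fun a ha => green_eq_zero_left (by simpa)) (fun a ha => green_eq_zero_left (by simpa))
  have e : ∀ v ∈ W, ∀ f : Site d → ℂ,
      ∑ u ∈ W, f u * diffOp lam V z (fun a => green lam V (W : Set (Site d)) z a v) u = f v := by
    intro v hv f
    rw [Finset.sum_congr rfl fun u hu => by
      rw [diffOp_green (boundedOn_finset V W) hR (by simpa using hu) (by simpa using hv)]]
    simp [hv]
  rw [e y hy, e x hx] at h
  exact h.symm

/-- Pairing with a row of the Green function inverts `H_W - z`. -/
theorem sum_green_mul_diffOp {d : ℕ} {lam : ℝ} {V : Site d → ℝ} {W : Finset (Site d)} {z : ℂ}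
    (hR : Resolvent lam V (W : Set (Site d)) z) {g : Site d → ℂ} {x : Site d} (hx : x ∈ W)
    (hg : ∀ a ∉ W, g a = 0) :
    ∑ u ∈ W, green lam V (W : Set (Site d)) z x u * diffOp lam V z g u = g x := by
  classical
  simp only [green_symm hR x]
  rw [diffOp_symm (fun a ha => green_eq_zero_left (by simpa)) hg,
    Finset.sum_congr rfl fun u hu => by
      rw [diffOp_green (boundedOn_finset V W) hR (by simpa using hu) (by simpa using hx)]]
  simp [hx]

/-- Uniqueness of the column of the resolvent; it serves to identify translated Green functions. -/
theorem eq_green_of_diffOp {d : ℕ} {lam : ℝ} {V : Site d → ℝ} {W : Finset (Site d)} {z : ℂ}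
    (hR : Resolvent lam V (W : Set (Site d)) z) {g : Site d → ℂ} {y : Site d} (hy : y ∈ W)
    (hg : ∀ a ∉ W, g a = 0) (h : ∀ u ∈ W, diffOp lam V z g u = if u = y then 1 else 0)
    (x : Site d) : g x = green lam V (W : Set (Site d)) z x y := by
  classical
  by_cases hx : x ∈ W
  · rw [← sum_green_mul_diffOp hR hx hg, Finset.sum_congr rfl fun u hu => by rw [h u hu]]
    simp [hy]
  · rw [hg x hx, green_eq_zero_left (by simpa)]

theorem sum_boundaryBonds {d : ℕ} {M : Type*} [AddCommMonoid M] (W : Finset (Site d))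
    (F : Site d → Site d → M) :
    ∑ b ∈ boundaryBonds W, F b.1 b.2 = ∑ u ∈ W, ∑ v ∈ (nbrs u).filter (· ∉ W), F u v := by
  rw [Finset.sum_sigma']
  refine Finset.sum_bij' (fun b _ => ⟨b.1, b.2⟩) (fun p _ => (p.1, p.2)) ?_ ?_ ?_ ?_ ?_
  · intro b hb
    simp only [boundaryBonds, Finset.mem_filter, Finset.mem_product] at hb
    simp [hb.1.1, hb.2.1, hb.2.2]
  · intro p hp
    simp only [Finset.mem_sigma, Finset.mem_filter] at hp
    simp only [boundaryBonds, Finset.mem_filter, Finset.mem_product, fatten, Finset.mem_union,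
      Finset.mem_biUnion]
    exact ⟨⟨hp.1, .inr ⟨p.1, hp.1, hp.2.1⟩⟩, hp.2.1, hp.2.2⟩
  · intros; rfl
  · intros; rfl
  · intros; rfl

/-- The geometric resolvent identity. -/
theorem green_eq_add_boundary {d : ℕ} {lam : ℝ} {V : Site d → ℝ} {W : Finset (Site d)}
    {Ω : Set (Site d)} {z : ℂ} (hV : BoundedOn V Ω)
    (hRW : Resolvent lam V (W : Set (Site d)) z) (hR : Resolvent lam V Ω z)
    (hW : (W : Set (Site d)) ⊆ Ω) {x y : Site d} (hx : x ∈ W) (hy : y ∈ Ω) :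
    green lam V Ω z x y = green lam V (W : Set (Site d)) z x y +
      ∑ b ∈ boundaryBonds W, green lam V (W : Set (Site d)) z x b.1 * green lam V Ω z b.2 y := by
  classical
  set G : Site d → ℂ := fun a => green lam V Ω z a y with hG
  -- The column of `G_Ω` cut off to `W`. Applying `H_W - z` to it returns the point source plus the
  -- values of `G_Ω` across the cut bonds; pairing with a row of `G_W` then gives the identity.
  set g : Site d → ℂ := fun a => if a ∈ W then G a else 0 with hgdef
  have h1 := sum_green_mul_diffOp hRW (g := g) hx fun a ha => by simp [hgdef, ha]
  have h2 : ∀ u ∈ W, diffOp lam V z g u =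
      (if u = y then 1 else 0) + ∑ v ∈ (nbrs u).filter (· ∉ W), G v := by
    intro u hu
    rw [← diffOp_green hV hR (hW hu) hy]
    simp only [diffOp, hgdef, hu, if_true]
    rw [← Finset.sum_filter, ← Finset.sum_filter_add_sum_filter_not (nbrs u) (· ∈ W)]
    ring
  have h3 : ∑ b ∈ boundaryBonds W, green lam V (W : Set (Site d)) z x b.1 * G b.2 =
      ∑ u ∈ W, green lam V (W : Set (Site d)) z x u * ∑ v ∈ (nbrs u).filter (· ∉ W), G v := by
    simp only [Finset.mul_sum]
    exact sum_boundaryBonds W fun u v => green lam V (W : Set (Site d)) z x u * G v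
  have h4 : g x = G x := by simp [hgdef, hx]
  change G x = _ + ∑ b ∈ boundaryBonds W, green lam V (W : Set (Site d)) z x b.1 * G b.2
  rw [← h4, ← h1, Finset.sum_congr rfl fun u hu => by rw [h2 u hu, mul_add],
    Finset.sum_add_distrib, ← h3]
  congr 1
  by_cases hyW : y ∈ W
  · simp [hyW]
  · rw [green_eq_zero_right (by simpa)]
    refine Finset.sum_eq_zero fun u hu => ?_
    rw [if_neg (by rintro rfl; exact hyW hu), mul_zero]

/-! ### Self-adjointness and the resolvent set -/

theorem inner_eq_tsum_zeroExt {d : ℕ} {Ω : Set (Site d)} (ψ φ : Ω → ℂ) (e : Site d) :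
    ∑' x : Ω, inner ℂ (zeroExt ψ (x.1 + e)) (φ x) =
      ∑' x : Site d, inner ℂ (zeroExt ψ (x + e)) (zeroExt φ x) := by
  rw [← tsum_subtype_eq_of_support_subset (s := Ω)]
  · refine tsum_congr fun x => ?_
    simp [zeroExt]
  · intro x hx
    by_contra h
    exact hx (by simp [zeroExt, h])

/-- Shifts are bijections of the whole lattice, so after extension by zero the adjoint of the shift
by `e` is the shift by `-e`. Conjugation turns the one-sided lemma into its mirror image. -/
theorem tsum_inner_zeroExt_shift {d : ℕ} {Ω : Set (Site d)} (ψ φ : Ω → ℂ) (e : Site d) :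
    ∑' x : Ω, inner ℂ (zeroExt ψ (x.1 + e)) (φ x) =
      ∑' x : Ω, inner ℂ (ψ x) (zeroExt φ (x.1 - e)) := by
  have h := congrArg star (inner_eq_tsum_zeroExt φ ψ (-e))
  have h' : ∀ a b : ℂ, star (inner ℂ a b) = inner ℂ b a := fun a b => inner_conj_symm b a
  simp only [tsum_star, h', ← sub_eq_add_neg] at h
  rw [inner_eq_tsum_zeroExt, h, ← (Equiv.subRight e).tsum_eq]
  simp

theorem hamFun_eq_sub_sum {d : ℕ} (lam : ℝ) (V : Site d → ℝ) {Ω : Set (Site d)} (χ : Ω → ℂ)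
    (x : Ω) : hamFun lam V Ω χ x = ((2 * d + lam * V x.1 : ℝ) : ℂ) * χ x
      - ∑ i, (zeroExt χ (x.1 + unitVec i) + zeroExt χ (x.1 + -unitVec i)) := by
  rw [hamFun]
  simp only [← sub_eq_add_neg, sub_sub, Finset.sum_sub_distrib,
    Finset.sum_const, Finset.card_univ, Fintype.card_fin, nsmul_eq_mul]
  push_cast
  ring

theorem summable_inner_of_memℓp {ι : Type*} {χ ξ : ι → ℂ} (hχ : Memℓp χ 2) (hξ : Memℓp ξ 2) :
    Summable fun x => inner ℂ (χ x) (ξ x) :=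
  lp.summable_inner (⟨χ, hχ⟩ : lp (fun _ : ι => ℂ) 2) ⟨ξ, hξ⟩

theorem tsum_inner_hamFun {d : ℕ} (lam : ℝ) {V : Site d → ℝ} {Ω : Set (Site d)}
    (hV : BoundedOn V Ω) {ψ φ : Ω → ℂ} (hψ : Memℓp ψ 2) (hφ : Memℓp φ 2) :
    ∑' x, inner ℂ (hamFun lam V Ω ψ x) (φ x) = ∑' x, inner ℂ (ψ x) (hamFun lam V Ω φ x) := by
  have hsh : ∀ {χ : Ω → ℂ}, Memℓp χ 2 → ∀ e : Site d,
      Memℓp (fun x : Ω => zeroExt χ (x.1 + e)) 2 := fun hχ e =>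
    memℓp_zeroExt_comp hχ fun a b h => Subtype.ext (by simpa using h)
  have hs1 := fun e : Site d => summable_inner_of_memℓp (hsh hψ e) hφ
  have hs2 := fun e : Site d => summable_inner_of_memℓp hψ (hsh hφ e)
  have hp : ∀ {χ : Ω → ℂ}, Memℓp χ 2 →
      Memℓp (fun x : Ω => ((2 * d + lam * V x.1 : ℝ) : ℂ) * χ x) 2 := fun {χ} hχ => by
    have := (memℓp_hamFun lam hV hχ).add
      (Memℓp.finsetSum Finset.univ fun i _ => (hsh hχ (unitVec i)).add (hsh hχ (-unitVec i)))
    convert this using 1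
    funext x
    simp [hamFun_eq_sub_sum]
  simp only [hamFun_eq_sub_sum, inner_sub_left, inner_sub_right, sum_inner, inner_sum,
    inner_add_left, inner_add_right]
  rw [Summable.tsum_sub (summable_inner_of_memℓp (hp hψ) hφ)
      (summable_sum fun i _ => (hs1 _).add (hs1 _)),
    Summable.tsum_sub (summable_inner_of_memℓp hψ (hp hφ))
      (summable_sum fun i _ => (hs2 _).add (hs2 _)),
    Summable.tsum_finsetSum fun i _ => (hs1 _).add (hs1 _),
    Summable.tsum_finsetSum fun i _ => (hs2 _).add (hs2 _)]
  congr 1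
  · refine tsum_congr fun x => ?_
    simp only [RCLike.inner_apply, map_mul, Complex.conj_ofReal]
    ring
  · refine Finset.sum_congr rfl fun i _ => ?_
    rw [Summable.tsum_add (hs1 _) (hs1 _), Summable.tsum_add (hs2 _) (hs2 _),
      tsum_inner_zeroExt_shift, tsum_inner_zeroExt_shift, add_comm]
    simp only [sub_eq_add_neg, neg_neg]

theorem isSelfAdjoint_ham {d : ℕ} (lam : ℝ) (V : Site d → ℝ) (Ω : Set (Site d)) :
    IsSelfAdjoint (ham lam V Ω) := by
  by_cases hV : BoundedOn V Ω
  swap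
  · simp [ham, hV]
  refine ContinuousLinearMap.isSelfAdjoint_iff_isSymmetric.2 fun ψ φ => ?_
  have h1 := lp.inner_eq_tsum (𝕜 := ℂ) (ham lam V Ω ψ) φ
  have h2 := lp.inner_eq_tsum (𝕜 := ℂ) ψ (ham lam V Ω φ)
  simp only [ham_apply lam hV] at h1 h2
  exact h1.trans ((tsum_inner_hamFun lam hV ψ.2 φ.2).trans h2.symm)

theorem resolvent_of_im_ne_zero {d : ℕ} (lam : ℝ) (V : Site d → ℝ) (Ω : Set (Site d)) {z : ℂ}
    (hz : z.im ≠ 0) : Resolvent lam V Ω z := by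
  have h : z ∉ spectrum ℂ (ham lam V Ω) := fun h =>
    hz ((isSelfAdjoint_ham lam V Ω).im_eq_zero_of_mem_spectrum h)
  have h2 := (spectrum.notMem_iff.1 h).neg
  rw [Algebra.algebraMap_eq_smul_one, neg_sub] at h2
  exact h2

/-! ### Regularity of the Green function in the potential and in the energy -/

/-- Exhibits `H_W` as an affine function of finitely many values of `V`: each difference of two
`ham` terms is the projection onto the site `a`. Norm continuity in `V` follows. -/
theorem ham_eq_add_sum {d : ℕ} (lam : ℝ) (V : Site d → ℝ) (W : Finset (Site d)) :
    ham lam V (W : Set (Site d)) = ham 0 0 (W : Set (Site d)) + ∑ a ∈ W, ((lam * V a : ℝ) : ℂ) •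
      (ham 1 (Pi.single a 1) (W : Set (Site d)) - ham 1 0 (W : Set (Site d))) := by
  classical
  ext ψ x
  have h := fun lam V => ham_apply lam (boundedOn_finset V W) ψ x
  have hs : ∀ (s : Finset (Site d)) (F : Site d → L2 (W : Set (Site d))),
      (∑ a ∈ s, F a : L2 (W : Set (Site d))) x = ∑ a ∈ s, F a x := fun s F =>
    map_sum (lp.evalCLM ℂ (fun _ : (W : Set (Site d)) => ℂ) 2 x) F s
  simp only [_root_.add_apply, _root_.sum_apply, lp.coeFn_add,
    Pi.add_apply, hs, _root_.smul_apply, lp.coeFn_smul, Pi.smul_apply,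
    _root_.sub_apply, lp.coeFn_sub, Pi.sub_apply, h, hamFun, smul_eq_mul]
  simp only [zero_mul, one_mul, Pi.zero_apply, Complex.ofReal_zero, add_zero]
  congr 1
  rw [Finset.sum_eq_single x.1]
  · simp
  · intro a _ ha
    simp [ha.symm]
  · exact fun hx => absurd x.2 hx

theorem isOpen_resolvent_and_continuousOn_green {d : ℕ} (lam : ℝ) (W : Finset (Site d))
    (x y : Site d) :
    IsOpen {p : (Site d → ℝ) × ℂ | Resolvent lam p.1 (W : Set (Site d)) p.2} ∧
    ∀ p : (Site d → ℝ) × ℂ, Resolvent lam p.1 (W : Set (Site d)) p.2 →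
      ContinuousAt (fun p : (Site d → ℝ) × ℂ => green lam p.1 (W : Set (Site d)) p.2 x y) p := by
  have hc : Continuous fun p : (Site d → ℝ) × ℂ => ham lam p.1 (W : Set (Site d))
      - p.2 • (1 : L2 (W : Set (Site d)) →L[ℂ] L2 (W : Set (Site d))) := by
    simp only [ham_eq_add_sum lam]
    refine (continuous_const.add (continuous_finsetSum _ fun a _ => ?_)).sub
      (continuous_snd.smul continuous_const)
    exact (Complex.continuous_ofReal.comp (continuous_const.mul
      ((continuous_apply a).comp continuous_fst))).smul continuous_const
  refine ⟨Units.isOpen.preimage hc, ?_⟩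
  rintro p ⟨u, hu⟩
  by_cases h : x ∈ (W : Set (Site d)) ∧ y ∈ (W : Set (Site d))
  swap
  · simp only [green, h, dite_false]
    exact continuousAt_const
  simp only [green, h, and_self, dite_true]
  have h1 : ContinuousAt (fun p : (Site d → ℝ) × ℂ =>
      Ring.inverse (ham lam p.1 (W : Set (Site d))
      - p.2 • (1 : L2 (W : Set (Site d)) →L[ℂ] L2 (W : Set (Site d))))) p :=
    ContinuousAt.comp (g := Ring.inverse) (hu ▸ NormedRing.inverse_continuousAt u) hc.continuousAt
  exact ((lp.evalCLM ℂ (fun _ : (W : Set (Site d)) => ℂ) 2 ⟨x, h.1⟩).continuous.continuousAt).comp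
    (h1.clm_apply continuousAt_const)

/-! ### Energy identity and convergence along finite regions -/

theorem card_nbrs_le {d : ℕ} (x : Site d) : (nbrs x).card ≤ 2 * d := by
  refine (Finset.card_union_le _ _).trans ?_
  have h : ∀ f : Fin d → Site d, (Finset.univ.image f).card ≤ d := fun f =>
    Finset.card_image_le.trans (by simp)
  have := h fun i => x + unitVec i
  have := h fun i => x - unitVec i
  omega

theorem mem_boundaryBonds {d : ℕ} {W : Finset (Site d)} {b : Site d × Site d} :
    b ∈ boundaryBonds W ↔ b.1 ∈ W ∧ b.2 ∈ nbrs b.1 ∧ b.2 ∉ W := by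
  simp only [boundaryBonds, Finset.mem_filter, Finset.mem_product, fatten, Finset.mem_union,
    Finset.mem_biUnion]
  exact ⟨fun h => ⟨h.1.1, h.2⟩, fun h => ⟨⟨h.1, .inr ⟨b.1, h.1, h.2.1⟩⟩, h.2⟩⟩

theorem sum_boundaryBonds_fst_le {d : ℕ} (W : Finset (Site d)) {f : Site d → ℝ}
    (hf : ∀ a, 0 ≤ f a) : ∑ b ∈ boundaryBonds W, f b.1 ≤ (2 * d : ℕ) * ∑ u ∈ W, f u := by
  rw [sum_boundaryBonds W fun u _ => f u, Finset.mul_sum]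
  refine Finset.sum_le_sum fun u _ => ?_
  rw [Finset.sum_const, nsmul_eq_mul]
  refine mul_le_mul_of_nonneg_right ?_ (hf u)
  exact_mod_cast (Finset.card_filter_le _ _).trans (card_nbrs_le u)

theorem sum_boundaryBonds_snd_le {d : ℕ} (W : Finset (Site d)) {f : Site d → ℝ}
    (hf : ∀ a, 0 ≤ f a) :
    ∑ b ∈ boundaryBonds W, f b.2 ≤ (2 * d : ℕ) * ∑ v ∈ fatten W \ W, f v := by
  have hmaps : ∀ b ∈ boundaryBonds W, b.2 ∈ fatten W \ W := by
    intro b hb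
    rw [boundaryBonds, Finset.mem_filter, Finset.mem_product] at hb
    exact Finset.mem_sdiff.2 ⟨hb.1.2, hb.2.2⟩
  rw [← Finset.sum_fiberwise_of_maps_to hmaps, Finset.mul_sum]
  refine Finset.sum_le_sum fun v _ => ?_
  rw [Finset.sum_congr rfl fun b hb => by rw [(Finset.mem_filter.1 hb).2], Finset.sum_const,
    nsmul_eq_mul]
  refine mul_le_mul_of_nonneg_right ?_ (hf v)
  have : ((boundaryBonds W).filter fun b => b.2 = v).card ≤ (nbrs v).card := by
    refine Finset.card_le_card_of_injOn (fun b => b.1) ?_ ?_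
    · intro b hb
      simp only [Finset.coe_filter, Set.mem_ofPred_eq, mem_boundaryBonds] at hb
      have := mem_nbrs_comm.1 hb.1.2.1
      rwa [hb.2] at this
    · intro b hb c hc h
      simp only [Finset.coe_filter, Set.mem_ofPred_eq] at hb hc
      exact Prod.ext h (hb.2.trans hc.2.symm)
  exact_mod_cast this.trans (card_nbrs_le v)

/-- At `z = 0` the quadratic form is real, so only the term `-z ‖g‖²` has an imaginary part. -/
theorem im_sum_conj_mul_diffOp {d : ℕ} (lam : ℝ) (V : Site d → ℝ) (z : ℂ) {W : Finset (Site d)}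
    {g : Site d → ℂ} (hg : ∀ a ∉ W, g a = 0) :
    (∑ u ∈ W, star (g u) * diffOp lam V z g u).im = -z.im * ∑ u ∈ W, ‖g u‖ ^ 2 := by
  have hz : ∀ u, diffOp lam V z g u = diffOp lam V 0 g u - z * g u := fun u => by
    simp only [diffOp]; ring
  have h0 : (∑ u ∈ W, star (g u) * diffOp lam V 0 g u).im = 0 := by
    have h := diffOp_symm (lam := lam) (V := V) (z := 0) (f := fun u => star (g u))
      (fun a ha => by simp [hg a ha]) hg
    have h2 : ∀ u, diffOp lam V 0 (fun u => star (g u)) u = star (diffOp lam V 0 g u) := fun u => by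
      simp [diffOp]
    simp only [h2] at h
    rw [← Complex.conj_eq_iff_im]
    conv_rhs => rw [h]
    rw [map_sum]
    exact Finset.sum_congr rfl fun u _ => by simp
  simp only [hz, mul_sub, Finset.sum_sub_distrib, Complex.sub_im, h0, zero_sub]
  rw [Complex.im_sum, Finset.mul_sum, ← Finset.sum_neg_distrib]
  refine Finset.sum_congr rfl fun u _ => ?_
  rw [← Complex.normSq_eq_norm_sq, Complex.normSq_apply]
  simp only [Complex.mul_im, Complex.mul_re, Complex.star_def, Complex.conj_re, Complex.conj_im]
  ring

/-- With `N` the sum of squares, the energy identity gives `|Im z| N = |Im G(x,x)| ≤ √N`, as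
`|G(x,x)|²` is one of the summands of `N`. -/
theorem sum_norm_green_sq_le {d : ℕ} {lam : ℝ} {V : Site d → ℝ} {W : Finset (Site d)} {z : ℂ}
    (hz : z.im ≠ 0) (x : Site d) :
    ∑ u ∈ W, ‖green lam V (W : Set (Site d)) z x u‖ ^ 2 ≤ (1 / |z.im|) ^ 2 := by
  have hR := resolvent_of_im_ne_zero lam V (W : Set (Site d)) hz
  by_cases hx : x ∈ W
  swap
  · rw [Finset.sum_eq_zero fun u _ => by rw [green_eq_zero_left (by simpa)]; simp]
    positivity
  simp only [green_symm hR x]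
  set g : Site d → ℂ := fun a => green lam V (W : Set (Site d)) z a x
  have h := im_sum_conj_mul_diffOp lam V z (g := g) (W := W) fun a ha =>
    green_eq_zero_left (by simpa)
  rw [Finset.sum_congr rfl fun u hu => by
    rw [diffOp_green (boundedOn_finset V W) hR (by simpa using hu) (by simpa using hx)]] at h
  simp only [mul_ite, mul_one, mul_zero, Finset.sum_ite_eq', hx, if_true] at h
  set N := ∑ u ∈ W, ‖g u‖ ^ 2
  have hN : ‖g x‖ ^ 2 ≤ N :=
    Finset.single_le_sum (f := fun u => ‖g u‖ ^ 2) (fun _ _ => by positivity) hx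
  have h1 : |z.im| * N ≤ ‖g x‖ := by
    have h2 : |z.im| * N = |(star (g x)).im| := by
      rw [h, abs_mul, abs_neg, abs_of_nonneg (a := N) (Finset.sum_nonneg fun _ _ => by positivity)]
    rw [h2]
    exact (Complex.abs_im_le_norm _).trans (by simp)
  have hpos : 0 < |z.im| := abs_pos.2 hz
  have hN0 : 0 ≤ N := le_trans (by positivity) hN
  rw [div_pow, one_pow, le_div_iff₀ (by positivity)]
  have h3 : |z.im| ^ 2 * N ^ 2 ≤ N := by
    calc |z.im| ^ 2 * N ^ 2 = (|z.im| * N) ^ 2 := by ring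
      _ ≤ ‖g x‖ ^ 2 := by gcongr
      _ ≤ N := hN
  rcases hN0.eq_or_lt with h0 | h0
  · rw [← h0]; simp
  · by_contra hcon
    push Not at hcon
    nlinarith

theorem summable_norm_green_sq {d : ℕ} (lam : ℝ) (V : Site d → ℝ) (Ω : Set (Site d)) (z : ℂ)
    (y : Site d) : Summable fun a => ‖green lam V Ω z a y‖ ^ 2 := by
  by_cases hy : y ∈ Ω
  swap
  · simp only [green_eq_zero_right hy]
    simp
  have h2 : 0 < (2 : ℝ≥0∞).toReal := by norm_num
  have h := (memℓp_gen_iff h2).1 (greenVec lam V Ω z ⟨y, hy⟩).2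
  refine (Function.Injective.summable_iff (Subtype.val_injective (p := (· ∈ Ω))) ?_).1 ?_
  · intro a ha
    rw [green_eq_zero_left (by simpa using ha)]
    simp
  · convert h using 2 with a
    simp [green, greenVec, hy]

/-- The box `[-L, L]^d`. -/
noncomputable def box (d L : ℕ) : Finset (Site d) := Fintype.piFinset fun _ => Finset.Icc (-(L : ℤ)) L

theorem tendsto_box (d : ℕ) : Tendsto (box d) atTop atTop := by
  refine tendsto_atTop_finset_of_monotone ?_ ?_
  · intro L L' h
    refine Fintype.piFinset_subset _ _ fun _ => Finset.Icc_subset_Icc ?_ ?_ <;> simp [h]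
  · intro x
    refine ⟨∑ i, (x i).natAbs, ?_⟩
    simp only [box, Fintype.mem_piFinset, Finset.mem_Icc]
    intro i
    have := Finset.single_le_sum (f := fun i => (x i).natAbs) (fun _ _ => by positivity)
      (Finset.mem_univ i)
    omega

open Classical in
/-- The part of a region inside the box `[-L, L]^d`. -/
noncomputable def cut {d : ℕ} (Ω : Set (Site d)) (L : ℕ) : Finset (Site d) :=
  (box d L).filter (· ∈ Ω)

theorem coe_cut {d : ℕ} (Ω : Set (Site d)) (L : ℕ) :
    (cut Ω L : Set (Site d)) = ↑(box d L) ∩ Ω := by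
  ext; simp [cut]

theorem mem_cut {d : ℕ} {Ω : Set (Site d)} {L : ℕ} {a : Site d} :
    a ∈ cut Ω L ↔ a ∈ box d L ∧ a ∈ Ω := by
  simp [cut]

/-- The error is a sum over cut bonds. By Cauchy–Schwarz it is at most the norm of a row of `G_W`,
bounded through `1/|Im z|`, times the tail of a square-summable column of `G_Ω` outside the box. -/
theorem tendsto_green_cut {d : ℕ} {lam : ℝ} {V : Site d → ℝ} {Ω : Set (Site d)} {z : ℂ}
    (hV : BoundedOn V Ω) (hz : z.im ≠ 0) {x y : Site d} (hx : x ∈ Ω) (hy : y ∈ Ω) :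
    Tendsto (fun L => green lam V (cut Ω L : Set (Site d)) z x y) atTop
      (𝓝 (green lam V Ω z x y)) := by
  rw [Metric.tendsto_atTop']
  intro ε hε
  set c : ℝ := ((2 * d : ℕ) : ℝ) * (1 / |z.im|) ^ 2
  set k : ℝ := ((2 * d : ℕ) : ℝ)
  have hc : 0 ≤ c := by positivity
  have hk : 0 ≤ k := by positivity
  obtain ⟨s, hs⟩ := summable_iff_vanishing_norm.1 (summable_norm_green_sq lam V Ω z y)
    (ε ^ 2 / (c * k + 1)) (by positivity)
  obtain ⟨N, hN⟩ := ((tendsto_box d).eventually (eventually_ge_atTop (s ∪ {x}))).exists_forall_of_atTop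
  refine ⟨N, fun L hL => ?_⟩
  have hL := hN L hL.le
  set W := cut Ω L with hWdef
  have hWΩ : (W : Set (Site d)) ⊆ Ω := by rw [coe_cut]; exact Set.inter_subset_right
  have hxW : x ∈ W := by
    rw [hWdef, mem_cut]
    exact ⟨hL (by simp), hx⟩
  have hid := green_eq_add_boundary hV (resolvent_of_im_ne_zero lam V (W : Set (Site d)) hz)
    (resolvent_of_im_ne_zero lam V Ω hz) hWΩ hxW hy
  rw [dist_comm, dist_eq_norm, hid, add_sub_cancel_left]
  have h1 : ‖∑ b ∈ boundaryBonds W, green lam V (W : Set (Site d)) z x b.1 *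
      green lam V Ω z b.2 y‖ ^ 2 ≤ c * (k * (ε ^ 2 / (c * k + 1))) := by
    calc _ ≤ (∑ b ∈ boundaryBonds W, ‖green lam V (W : Set (Site d)) z x b.1‖ *
            ‖green lam V Ω z b.2 y‖) ^ 2 := by
          gcongr
          refine (norm_sum_le _ _).trans (le_of_eq ?_)
          simp
      _ ≤ (∑ b ∈ boundaryBonds W, ‖green lam V (W : Set (Site d)) z x b.1‖ ^ 2) *
            ∑ b ∈ boundaryBonds W, ‖green lam V Ω z b.2 y‖ ^ 2 :=
          Finset.sum_mul_sq_le_sq_mul_sq _ _ _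
      _ ≤ c * (k * (ε ^ 2 / (c * k + 1))) := by
          gcongr
          · refine (sum_boundaryBonds_fst_le W
              (f := fun a => ‖green lam V (W : Set (Site d)) z x a‖ ^ 2)
              fun _ => by positivity).trans ?_
            exact mul_le_mul_of_nonneg_left (sum_norm_green_sq_le hz x) (by positivity)
          · refine (sum_boundaryBonds_snd_le W (f := fun a => ‖green lam V Ω z a y‖ ^ 2)
              fun _ => by positivity).trans ?_
            refine mul_le_mul_of_nonneg_left ?_ (by positivity)
            classical
            -- Sites outside `Ω` contribute zero; a site of `Ω` that is not in the cut-off lies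
            -- outside the box.
            rw [← Finset.sum_filter_of_ne (p := (· ∈ Ω))]
            · refine (le_abs_self _).trans (hs _ ?_).le
              rw [Finset.disjoint_left]
              intro a ha has
              simp only [Finset.mem_filter, Finset.mem_sdiff] at ha
              refine ha.1.2 ?_
              rw [hWdef, mem_cut]
              exact ⟨hL (by simp [has]), ha.2⟩
            · intro a _ ha
              by_contra h
              exact ha (by rw [green_eq_zero_left h]; simp)
  have h2 : c * (k * (ε ^ 2 / (c * k + 1))) < ε ^ 2 := by
    rw [show c * (k * (ε ^ 2 / (c * k + 1))) = ε ^ 2 * (c * k) / (c * k + 1) by ring,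
      div_lt_iff₀ (by positivity)]
    nlinarith [pow_pos hε 2]
  exact lt_of_pow_lt_pow_left₀ 2 hε.le (h1.trans_lt h2)

/-! ### Exceptional values of the potential at a fixed energy -/

theorem exists_of_not_resolvent {d : ℕ} {lam : ℝ} {V : Site d → ℝ} {W : Finset (Site d)} {z : ℂ}
    (h : ¬ Resolvent lam V (W : Set (Site d)) z) :
    ∃ g : Site d → ℂ, (∀ a ∉ W, g a = 0) ∧ (∃ a, g a ≠ 0) ∧
      ∀ u ∈ W, diffOp lam V z g u = 0 := by
  classical
  have : FiniteDimensional ℂ (L2 (W : Set (Site d))) :=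
    (lpPiLpₗᵢ (p := 2) (fun _ : (W : Set (Site d)) => ℂ) ℂ).symm.toLinearEquiv.finiteDimensional
  set T := ham lam V (W : Set (Site d)) - z • (1 : L2 (W : Set (Site d)) →L[ℂ] _) with hT
  have h1 : ¬ Function.Injective T := fun hi => h <| by
    rw [Resolvent, ← hT, ContinuousLinearMap.isUnit_iff_bijective]
    exact ⟨hi, (LinearMap.injective_iff_surjective (f := (T : L2 (W : Set (Site d)) →ₗ[ℂ] _))).1 hi⟩
  rw [injective_iff_map_eq_zero] at h1
  push Not at h1
  obtain ⟨ψ, hψ, hne⟩ := h1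
  refine ⟨zeroExt ψ, fun a ha => by simp [zeroExt, ha], ?_, fun u hu => ?_⟩
  · by_contra hcon
    push Not at hcon
    refine hne ?_
    ext a
    have := hcon a.1
    have ha : a.1 ∈ W := a.2
    simpa [zeroExt, ha] using this
  · have hu' : u ∈ (W : Set (Site d)) := hu
    have e := diffOp_zeroExt (lam := lam) (V := V) (z := z) (⇑ψ) ⟨u, hu'⟩
    simp only at e
    rw [e, ← ham_apply lam (boundedOn_finset V W)]
    have := congrArg (fun φ : L2 (W : Set (Site d)) => φ ⟨u, hu'⟩) hψ
    exact this

theorem eq_zero_of_diffOp_eq_zero {d : ℕ} {lam : ℝ} {V : Site d → ℝ} {W : Finset (Site d)} {z : ℂ}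
    (hR : Resolvent lam V (W : Set (Site d)) z) {g : Site d → ℂ}
    (hg : ∀ a ∉ W, g a = 0) (h : ∀ u ∈ W, diffOp lam V z g u = 0) (x : Site d) : g x = 0 := by
  by_cases hx : x ∈ W
  · rw [← sum_green_mul_diffOp hR hx hg]
    exact Finset.sum_eq_zero fun u hu => by rw [h u hu, mul_zero]
  · exact hg x hx

theorem diffOp_congr {d : ℕ} {lam : ℝ} {V V' : Site d → ℝ} {z : ℂ} {g : Site d → ℂ} {x : Site d}
    (h : V x = V' x) : diffOp lam V z g x = diffOp lam V' z g x := by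
  rw [diffOp, diffOp, h]

theorem hamFun_congr {d : ℕ} {lam : ℝ} {V V' : Site d → ℝ} {Ω : Set (Site d)}
    (h : ∀ a ∈ Ω, V a = V' a) : hamFun lam V Ω = hamFun lam V' Ω := by
  funext ψ x
  rw [hamFun, hamFun, h x.1 x.2]

theorem ham_congr {d : ℕ} {lam : ℝ} {V V' : Site d → ℝ} {Ω : Set (Site d)}
    (h : ∀ a ∈ Ω, V a = V' a) : ham lam V Ω = ham lam V' Ω := by
  by_cases hV : BoundedOn V Ω
  · have hV' : BoundedOn V' Ω := by
      obtain ⟨M, hM⟩ := hV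
      exact ⟨M, fun x hx => h x hx ▸ hM x hx⟩
    ext ψ x
    rw [ham_apply lam hV, ham_apply lam hV', hamFun_congr h]
  · have hV' : ¬ BoundedOn V' Ω := by
      rintro ⟨M, hM⟩
      exact hV ⟨M, fun x hx => (h x hx).symm ▸ hM x hx⟩
    simp [ham, hV, hV']

theorem green_congr {d : ℕ} {lam : ℝ} {V V' : Site d → ℝ} {Ω : Set (Site d)}
    (h : ∀ a ∈ Ω, V a = V' a) : green lam V Ω = green lam V' Ω := by
  funext z x y
  simp only [green, ham_congr (lam := lam) h]

theorem diffOp_sub_smul {d : ℕ} {lam : ℝ} {V : Site d → ℝ} {z c : ℂ} {f g : Site d → ℂ}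
    {x : Site d} : diffOp lam V z (fun a => f a - c * g a) x =
      diffOp lam V z f x - c * diffOp lam V z g x := by
  simp only [diffOp, Finset.sum_sub_distrib, ← Finset.mul_sum]
  ring

/-- A null vector on `W ∪ {x}` cannot vanish at `x`, or it would be one on `W`. For the same reason
null vectors for two values `t`, `t'` are proportional, since a combination vanishing at `x` is
zero. Comparing the equations at `x` then forces `t = t'`. -/
theorem subsingleton_not_resolvent_update {d : ℕ} {lam : ℝ} (hlam : lam ≠ 0) {V : Site d → ℝ}
    {W : Finset (Site d)} {z : ℂ} (hR : Resolvent lam V (W : Set (Site d)) z) {x : Site d}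
    (hx : x ∉ W) :
    {t : ℝ | ¬ Resolvent lam (Function.update V x t) (insert x W : Finset (Site d)) z}.Subsingleton := by
  classical
  have hW : ∀ t, ∀ u ∈ W, V u = Function.update V x t u := fun t u hu => by
    rw [Function.update_of_ne (by rintro rfl; exact hx hu)]
  have hex : ∀ t, ¬ Resolvent lam (Function.update V x t) (insert x W : Finset (Site d)) z →
      ∃ g : Site d → ℂ, (∀ a ∉ insert x W, g a = 0) ∧ g x ≠ 0 ∧ (∀ u ∈ W, diffOp lam V z g u = 0) ∧
        diffOp lam (Function.update V x t) z g x = 0 := by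
    intro t ht
    obtain ⟨g, hg0, ⟨a, ha⟩, hg⟩ := exists_of_not_resolvent ht
    have hgW : ∀ u ∈ W, diffOp lam V z g u = 0 := fun u hu => by
      rw [diffOp_congr (hW t u hu)]; exact hg u (by simp [hu])
    refine ⟨g, hg0, fun h => ha ?_, hgW, hg x (by simp)⟩
    refine eq_zero_of_diffOp_eq_zero hR (fun b hb => ?_) hgW a
    by_cases hbx : b = x
    · rw [hbx, h]
    · exact hg0 b (by simp [hb, hbx])
  intro t ht t' ht'
  obtain ⟨g, hg0, hgx, hgW, hg⟩ := hex t ht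
  obtain ⟨f, hf0, hfx, hfW, hf⟩ := hex t' ht'
  set c := f x / g x with hc
  have heq : ∀ a, f a - c * g a = 0 := by
    refine eq_zero_of_diffOp_eq_zero hR (fun b hb => ?_) fun u hu => ?_
    · by_cases hbx : b = x
      · rw [hbx, hc]; field_simp; ring
      · rw [hf0 b (by simp [hb, hbx]), hg0 b (by simp [hb, hbx])]; simp
    · rw [diffOp_sub_smul, hfW u hu, hgW u hu]; simp
  have h1 : diffOp lam (Function.update V x t') z (fun a => f a - c * g a) x = 0 := by
    simp only [heq, diffOp]; simp
  rw [diffOp_sub_smul, hf, zero_sub, neg_eq_zero, mul_eq_zero] at h1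
  have hc0 : c ≠ 0 := div_ne_zero hfx hgx
  have h2 := h1.resolve_left hc0
  have h3 : ((lam * (t - t') : ℝ) : ℂ) * g x = 0 := by
    rw [← sub_self (0 : ℂ)]
    nth_rewrite 1 [← hg]
    rw [← h2]
    simp only [diffOp, Function.update_self]
    push_cast
    ring
  have h4 := (mul_eq_zero.1 h3).resolve_right hgx
  rw [Complex.ofReal_eq_zero, mul_eq_zero, sub_eq_zero] at h4
  exact h4.resolve_left hlam

/-! ### Dependence of the Green function on one or two values of the potential -/

theorem green_sub_green {d : ℕ} {lam : ℝ} {V V' : Site d → ℝ} {W : Finset (Site d)} {z : ℂ}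
    (hR : Resolvent lam V (W : Set (Site d)) z) (hR' : Resolvent lam V' (W : Set (Site d)) z)
    {a b : Site d} (ha : a ∈ W) (hb : b ∈ W) :
    green lam V' (W : Set (Site d)) z a b = green lam V (W : Set (Site d)) z a b -
      ∑ c ∈ W, green lam V (W : Set (Site d)) z a c *
        (((lam * (V' c - V c) : ℝ) : ℂ) * green lam V' (W : Set (Site d)) z c b) := by
  classical
  have h := sum_green_mul_diffOp hR (g := fun c => green lam V' (W : Set (Site d)) z c b) ha
    fun c hc => green_eq_zero_left (by simpa)
  have h2 : ∀ c ∈ W, diffOp lam V z (fun c => green lam V' (W : Set (Site d)) z c b) c =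
      (if c = b then 1 else 0) -
        ((lam * (V' c - V c) : ℝ) : ℂ) * green lam V' (W : Set (Site d)) z c b := by
    intro c hc
    rw [← diffOp_green (boundedOn_finset V' W) hR' (by simpa using hc) (by simpa using hb)]
    simp only [diffOp]
    push_cast
    ring
  rw [← h, Finset.sum_congr rfl fun c hc => by rw [h2 c hc, mul_sub], Finset.sum_sub_distrib]
  congr 1
  simp [hb]

/-- For a symmetric matrix `M` with entries `g₁, g₂, g₃`, `Im M⁻¹ = -M⁻¹ (Im M) (M⁻¹)*`; taking
determinants gives `det Im M⁻¹ = det Im M / |det M|²`. -/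
theorem im_mul_sub_sq_div {g₁ g₂ g₃ : ℂ} (h : g₁ * g₃ - g₂ ^ 2 ≠ 0) :
    (g₃ / (g₁ * g₃ - g₂ ^ 2)).im * (g₁ / (g₁ * g₃ - g₂ ^ 2)).im -
      (g₂ / (g₁ * g₃ - g₂ ^ 2)).im ^ 2 =
    (g₁.im * g₃.im - g₂.im ^ 2) / Complex.normSq (g₁ * g₃ - g₂ ^ 2) := by
  have hN : Complex.normSq (g₁ * g₃ - g₂ ^ 2) ≠ 0 := by simpa using h
  set D := g₁ * g₃ - g₂ ^ 2 with hD
  have h1 : D.re = g₁.re * g₃.re - g₁.im * g₃.im - (g₂.re ^ 2 - g₂.im ^ 2) := by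
    simp [hD, pow_two]
  have h2 : D.im = g₁.re * g₃.im + g₁.im * g₃.re - 2 * (g₂.re * g₂.im) := by
    simp [hD, pow_two]; ring
  have h3 := Complex.normSq_apply D
  simp only [Complex.div_im]
  field_simp
  rw [h3, h1, h2]
  ring

theorem sum_mul_update₂ {d : ℕ} {V : Site d → ℝ} {W : Finset (Site d)} {x y : Site d}
    (hx : x ∈ W) (hy : y ∈ W) (hxy : x ≠ y) (lam v w : ℝ) (f g : Site d → ℂ) :
    ∑ c ∈ W, f c * (((lam * (Function.update (Function.update V x v) y w c -
        Function.update (Function.update V x 0) y 0 c) : ℝ) : ℂ) * g c) =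
      f x * ((lam * v : ℝ) * g x) + f y * ((lam * w : ℝ) * g y) := by
  classical
  rw [← Finset.sum_subset (s₁ := {x, y}), Finset.sum_pair hxy]
  · simp [hxy]
  · intro c hc
    simp only [Finset.mem_insert, Finset.mem_singleton] at hc
    rcases hc with rfl | rfl <;> assumption
  · intro c _ hc
    simp only [Finset.mem_insert, Finset.mem_singleton, not_or] at hc
    simp [hc.1, hc.2]

/-- Apply the energy identity to `ψ = α G(·,x) + β G(·,y)`. If the block kills `(α, β)`, then `ψ`
vanishes at `x` and `y`, hence everywhere, so the block is invertible. For real `α` and `β = 1` the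
identity shows that `Im z` times the imaginary part of the form is nonnegative, which gives the
discriminant bound. -/
theorem green_block {d : ℕ} {lam : ℝ} {V : Site d → ℝ} {W : Finset (Site d)} {z : ℂ}
    (hz : z.im ≠ 0) {x y : Site d} (hx : x ∈ W) (hy : y ∈ W) (hxy : x ≠ y) :
    let G := green lam V (W : Set (Site d)) z
    G x x * G y y - G x y ^ 2 ≠ 0 ∧ (G x y).im ^ 2 ≤ (G x x).im * (G y y).im := by
  classical
  intro G
  have hR := resolvent_of_im_ne_zero lam V (W : Set (Site d)) hz
  have hsymm : G y x = G x y := green_symm hR y x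
  set ψ : ℂ → ℂ → Site d → ℂ := fun α β a => α * G a x + β * G a y with hψ
  have hψ0 : ∀ α β, ∀ a ∉ W, ψ α β a = 0 := fun α β a ha => by
    simp [hψ, G, green_eq_zero_left (Ω := (W : Set (Site d))) (x := a) (by simpa using ha)]
  have hD : ∀ α β, ∀ u ∈ W, diffOp lam V z (ψ α β) u =
      α * (if u = x then 1 else 0) + β * (if u = y then 1 else 0) := by
    intro α β u hu
    rw [← diffOp_green (boundedOn_finset V W) hR (by simpa using hu) (by simpa using hx),
      ← diffOp_green (boundedOn_finset V W) hR (by simpa using hu) (by simpa using hy)]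
    simp only [diffOp, hψ, Finset.sum_add_distrib, ← Finset.mul_sum, G]
    ring
  have hE : ∀ α β, (star (ψ α β x) * α + star (ψ α β y) * β).im =
      -z.im * ∑ u ∈ W, ‖ψ α β u‖ ^ 2 := by
    intro α β
    rw [← im_sum_conj_mul_diffOp lam V z (hψ0 α β), Finset.sum_congr rfl fun u hu => by
      rw [hD α β u hu, mul_add]]
    simp [Finset.sum_add_distrib, hx, hy]
  have hker : ∀ α β, α * G x x + β * G x y = 0 → α * G x y + β * G y y = 0 → α = 0 ∧ β = 0 := by
    intro α β h1 h2
    have hx0 : ψ α β x = 0 := h1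
    have hy0 : ψ α β y = 0 := by rw [← h2, ← hsymm]
    have h3 := hE α β
    rw [hx0, hy0] at h3
    simp only [star_zero, zero_mul, add_zero, Complex.zero_im] at h3
    have h4 := (mul_eq_zero.1 h3.symm).resolve_left (neg_ne_zero.2 hz)
    rw [Finset.sum_eq_zero_iff_of_nonneg fun _ _ => by positivity] at h4
    have h5 : ∀ u, ψ α β u = 0 := fun u => by
      by_cases hu : u ∈ W
      · simpa using h4 u hu
      · exact hψ0 α β u hu
    have h6 : ∀ u, diffOp lam V z (ψ α β) u = 0 := fun u => by simp [diffOp, h5]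
    have h7 := hD α β x hx
    have h8 := hD α β y hy
    rw [h6] at h7 h8
    exact ⟨by simpa [hxy] using h7.symm, by simpa [hxy.symm] using h8.symm⟩
  refine ⟨fun h => ?_, ?_⟩
  -- A zero determinant puts `(G(y,y), -G(x,y))` in the kernel, so both entries vanish; then `(0,
  -- 1)` is in the kernel too.
  · obtain ⟨h1, h2⟩ := hker (G y y) (-G x y) (by linear_combination h) (by ring)
    have h3 := (hker 0 1 (by rw [← neg_eq_zero]; linear_combination h2)
      (by linear_combination h1)).2
    exact one_ne_zero h3
  · have hq : ∀ r : ℝ, 0 ≤ z.im * (G x x).im * (r * r) + 2 * (z.im * (G x y).im) * r +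
        z.im * (G y y).im := by
      intro r
      have h1 := hE r 1
      simp only [hψ, hsymm] at h1
      have h2 : (star ((r : ℂ) * G x x + 1 * G x y) * r + star ((r : ℂ) * G x y + 1 * G y y) * 1).im
          = -((G x x).im * (r * r) + 2 * (G x y).im * r + (G y y).im) := by
        simp
        ring
      rw [h2, neg_mul, neg_inj] at h1
      have h3 : z.im * (G x x).im * (r * r) + 2 * (z.im * (G x y).im) * r + z.im * (G y y).im =
        z.im * z.im * ∑ u ∈ W, ‖ψ r 1 u‖ ^ 2 := by
        rw [mul_assoc z.im z.im, ← h1]; ring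
      rw [h3]
      exact mul_nonneg (mul_self_nonneg _) (Finset.sum_nonneg fun _ _ => by positivity)
    have h4 := discrim_le_zero hq
    rw [discrim] at h4
    have h5 : 0 < z.im ^ 2 := by positivity
    by_contra hcon
    push Not at hcon
    nlinarith

/-- Krein formula: if `M` is the block of the Green function at `{x, y}` when the potential vanishes
at both sites, the block for values `v`, `w` is the inverse of `M⁻¹ + lam diag(v, w)`. The witnesses
are `1/lam` times the entries of `M⁻¹`, with the sign of the off-diagonal one reversed. -/
theorem exists_green_update₂ {d : ℕ} {lam : ℝ} (hlam : lam ≠ 0) (V : Site d → ℝ)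
    {W : Finset (Site d)} {z : ℂ} (hz : z.im ≠ 0) {x y : Site d} (hx : x ∈ W) (hy : y ∈ W)
    (hxy : x ≠ y) :
    ∃ a b c : ℂ, b.im ^ 2 ≤ a.im * c.im ∧ ∀ v w : ℝ, (v + a) * (w + c) - b ^ 2 ≠ 0 ∧
      green lam (Function.update (Function.update V x v) y w) (W : Set (Site d)) z x y =
        b / (lam * ((v + a) * (w + c) - b ^ 2)) := by
  set V₀ := Function.update (Function.update V x 0) y 0
  obtain ⟨hD, hIm⟩ := green_block (lam := lam) (V := V₀) hz hx hy hxy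
  have hsymm₀ := green_symm (resolvent_of_im_ne_zero lam V₀ (W : Set (Site d)) hz) y x
  set g₁ := green lam V₀ (W : Set (Site d)) z x x
  set g₂ := green lam V₀ (W : Set (Site d)) z x y
  set g₃ := green lam V₀ (W : Set (Site d)) z y y
  set D := g₁ * g₃ - g₂ ^ 2 with hDdef
  have hl : (lam : ℂ) ≠ 0 := by exact_mod_cast hlam
  refine ⟨(lam : ℂ)⁻¹ * (g₃ / D), (lam : ℂ)⁻¹ * (g₂ / D), (lam : ℂ)⁻¹ * (g₁ / D), ?_, ?_⟩
  · have h1 := im_mul_sub_sq_div hD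
    have h2 : 0 ≤ (g₁.im * g₃.im - g₂.im ^ 2) / Complex.normSq D :=
      div_nonneg (by linarith) (Complex.normSq_nonneg _)
    rw [← h1] at h2
    have h3 : ∀ t : ℂ, ((lam : ℂ)⁻¹ * t).im = lam⁻¹ * t.im := fun t => by
      rw [← Complex.ofReal_inv, Complex.im_ofReal_mul]
    rw [h3, h3, h3]
    nlinarith [sq_nonneg lam⁻¹]
  · intro v w
    set V' := Function.update (Function.update V x v) y w with hV'
    have hR' := resolvent_of_im_ne_zero lam V' (W : Set (Site d)) hz
    have hid := fun a ha b hb => green_sub_green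
      (resolvent_of_im_ne_zero lam V₀ (W : Set (Site d)) hz) hR' (a := a) (b := b) ha hb
    have hsymm := green_symm hR' y x
    have e₁ := hid x hx x hx
    have e₂ := hid x hx y hy
    have e₃ := hid y hy x hx
    have e₄ := hid y hy y hy
    rw [sum_mul_update₂ hx hy hxy] at e₁ e₂ e₃ e₄
    rw [hsymm, hsymm₀] at e₃
    rw [hsymm] at e₁
    rw [hsymm₀] at e₄
    change _ = g₁ - (g₁ * _ + g₂ * _) at e₁
    change _ = g₂ - (g₁ * _ + g₂ * _) at e₂
    change _ = g₂ - (g₂ * _ + g₃ * _) at e₃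
    change _ = g₃ - (g₂ * _ + g₃ * _) at e₄
    set G₁ := green lam V' (W : Set (Site d)) z x x
    set G₂ := green lam V' (W : Set (Site d)) z x y
    set G₃ := green lam V' (W : Set (Site d)) z y y
    push_cast at e₁ e₂ e₃ e₄
    -- `m₁` to `m₄` are the four entries of the matrix equation saying that `M⁻¹ + lam diag(v, w)`
    -- inverts the new block.
    have m₁ : (g₃ / D + lam * v) * G₁ - g₂ / D * G₂ = 1 := by
      field_simp
      rw [hDdef]
      linear_combination g₃ * e₁ - g₂ * e₃
    have m₂ : (g₃ / D + lam * v) * G₂ - g₂ / D * G₃ = 0 := by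
      field_simp
      rw [hDdef]
      linear_combination g₃ * e₂ - g₂ * e₄
    have m₃ : -(g₂ / D) * G₁ + (g₁ / D + lam * w) * G₂ = 0 := by
      field_simp
      rw [hDdef]
      linear_combination g₁ * e₃ - g₂ * e₁
    have m₄ : -(g₂ / D) * G₂ + (g₁ / D + lam * w) * G₃ = 1 := by
      field_simp
      rw [hDdef]
      linear_combination g₁ * e₄ - g₂ * e₂
    set p := g₃ / D
    set q := g₁ / D
    set b := g₂ / D
    have hdet : ((p + lam * v) * (q + lam * w) - b ^ 2) * (G₁ * G₃ - G₂ ^ 2) = 1 := by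
      linear_combination (-b * G₂ + (q + lam * w) * G₃) * m₁ + m₄ -
        (-b * G₁ + (q + lam * w) * G₂) * m₂
    have hdet0 : (p + lam * v) * (q + lam * w) - b ^ 2 ≠ 0 := left_ne_zero_of_mul_eq_one hdet
    have hsc : (p + lam * v) * (q + lam * w) - b ^ 2 =
        lam ^ 2 * ((v + (lam : ℂ)⁻¹ * p) * (w + (lam : ℂ)⁻¹ * q) - ((lam : ℂ)⁻¹ * b) ^ 2) := by
      field_simp
      ring
    rw [hsc] at hdet0
    have hn := right_ne_zero_of_mul hdet0
    refine ⟨hn, ?_⟩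
    rw [eq_div_iff (mul_ne_zero hl hn)]
    have : G₂ * (lam ^ 2 * ((v + (lam : ℂ)⁻¹ * p) * (w + (lam : ℂ)⁻¹ * q) -
        ((lam : ℂ)⁻¹ * b) ^ 2)) = b := by
      rw [← hsc]
      linear_combination (q + lam * w) * m₂ + b * m₄
    field_simp at this ⊢
    linear_combination this

theorem exists_green_update {d : ℕ} {lam : ℝ} (hlam : lam ≠ 0) (V : Site d → ℝ)
    {W : Finset (Site d)} {z : ℂ} (hz : z.im ≠ 0) {x : Site d} (hx : x ∈ W) :
    ∃ a : ℂ, ∀ v : ℝ, v + a ≠ 0 ∧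
      green lam (Function.update V x v) (W : Set (Site d)) z x x = 1 / (lam * (v + a)) := by
  classical
  set V₀ := Function.update V x 0
  set g := green lam V₀ (W : Set (Site d)) z x x
  have hl : (lam : ℂ) ≠ 0 := by exact_mod_cast hlam
  have key : ∀ v : ℝ, green lam (Function.update V x v) (W : Set (Site d)) z x x =
      g - g * ((lam * v : ℝ) * green lam (Function.update V x v) (W : Set (Site d)) z x x) := by
    intro v
    have h := green_sub_green (resolvent_of_im_ne_zero lam V₀ (W : Set (Site d)) hz)
      (resolvent_of_im_ne_zero lam (Function.update V x v) (W : Set (Site d)) hz) hx hx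
    rw [Finset.sum_eq_single x] at h
    · simpa [V₀] using h
    · intro c _ hc
      simp [V₀, hc]
    · exact fun h => absurd hx h
  have hg : g ≠ 0 := by
    have hR := resolvent_of_im_ne_zero lam V₀ (W : Set (Site d)) hz
    have h := im_sum_conj_mul_diffOp lam V₀ z (W := W)
      (g := fun a => green lam V₀ (W : Set (Site d)) z a x) fun a ha => green_eq_zero_left (by simpa)
    rw [Finset.sum_congr rfl fun u hu => by
      rw [diffOp_green (boundedOn_finset V₀ W) hR (by simpa using hu) (by simpa using hx)]] at h
    simp only [mul_ite, mul_one, mul_zero, Finset.sum_ite_eq', hx, if_true] at h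
    intro h0
    change (star g).im = _ at h
    rw [h0] at h
    simp only [star_zero, Complex.zero_im] at h
    have h4 := (mul_eq_zero.1 h.symm).resolve_left (neg_ne_zero.2 hz)
    rw [Finset.sum_eq_zero_iff_of_nonneg fun _ _ => by positivity] at h4
    have h6 := diffOp_green (boundedOn_finset V₀ W) hR (x := x) (y := x) (by simpa using hx)
      (by simpa using hx)
    have h7 : ∀ a, green lam V₀ (W : Set (Site d)) z a x = 0 := fun a => by
      by_cases ha : a ∈ W
      · simpa using h4 a ha
      · exact green_eq_zero_left (by simpa)
    simp [diffOp, h7] at h6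
  refine ⟨1 / (lam * g), fun v => ?_⟩
  have h := key v
  set G := green lam (Function.update V x v) (W : Set (Site d)) z x x
  have h1 : G * (1 + lam * v * g) = g := by
    push_cast at h
    linear_combination h
  have h2 : 1 + lam * v * g ≠ 0 := right_ne_zero_of_mul (h1.symm ▸ hg)
  have h3 : (v : ℂ) + 1 / (lam * g) = (1 + lam * v * g) / (lam * g) := by field_simp; ring
  rw [h3]
  refine ⟨by positivity, ?_⟩
  rw [eq_div_iff (by positivity)]
  field_simp
  linear_combination h1

/-! ### The a priori bound on fractional moments -/

/-- The claim is `|det (R + iJ)| ≥ |det R|` for real symmetric `R` and semidefinite `J`. The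
polynomial `det (R + tJ) = X + ct + Yt²` has real roots when `Y ≠ 0`, whence `4XY ≤ c²`, and `|det|²
= (X - Y)² + c²`. -/
theorem sq_re_det_le_normSq {p q b : ℂ} (h : b.im ^ 2 ≤ p.im * q.im) :
    (p.re * q.re - b.re ^ 2) ^ 2 ≤ Complex.normSq (p * q - b ^ 2) := by
  set X := p.re * q.re - b.re ^ 2 with hX
  set Y := p.im * q.im - b.im ^ 2 with hY
  set c := p.re * q.im + p.im * q.re - 2 * (b.re * b.im) with hc
  have hY0 : 0 ≤ Y := by linarith
  have h1 : Complex.normSq (p * q - b ^ 2) = (X - Y) ^ 2 + c ^ 2 := by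
    rw [Complex.normSq_apply]
    simp [pow_two, hX, hY, hc]
    ring
  have h2 : 4 * X * Y ≤ c ^ 2 := by
    by_cases hp : p.im = 0
    · have hb : b.im ^ 2 = 0 := le_antisymm (by simpa [hp] using h) (sq_nonneg _)
      have : Y = 0 := by rw [hY, hp, hb]; ring
      rw [this]
      nlinarith [sq_nonneg c]
    · have h3 : p.im ^ 2 * (c ^ 2 - 4 * X * Y) =
          (c * p.im - 2 * Y * p.re) ^ 2 + 4 * Y * (p.im * b.re - p.re * b.im) ^ 2 := by
        rw [hX, hY, hc]; ring
      have h4 : 0 < p.im ^ 2 := by positivity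
      have h5 : 0 ≤ p.im ^ 2 * (c ^ 2 - 4 * X * Y) := by rw [h3]; positivity
      have := nonneg_of_mul_nonneg_right h5 h4
      linarith
  rw [h1]
  rcases le_total 0 X with h0 | h0
  · nlinarith [mul_nonneg h0 hY0]
  · nlinarith [mul_nonneg (neg_nonneg.2 h0) hY0, sq_nonneg c, sq_nonneg Y]

theorem enorm_div_det_le_inv {p q b : ℂ} (h : p * q - b ^ 2 ≠ 0) :
    ‖q‖ₑ / ‖p * q - b ^ 2‖ₑ ≤ ‖(p - b ^ 2 / q).re‖ₑ⁻¹ := by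
  by_cases hq : q = 0
  · simp [hq]
  have h1 : p * q - b ^ 2 = q * (p - b ^ 2 / q) := by field_simp
  have hq' : ‖q‖ₑ ≠ 0 := by simpa using hq
  rw [h1, enorm_mul, ENNReal.div_eq_inv_mul, ENNReal.mul_inv (.inl hq') (.inl enorm_ne_top),
    mul_comm ‖q‖ₑ⁻¹, mul_assoc, ENNReal.inv_mul_cancel hq' enorm_ne_top, mul_one]
  refine ENNReal.inv_le_inv.2 ?_
  rw [← ofReal_norm, ← ofReal_norm]
  exact ENNReal.ofReal_le_ofReal (Complex.abs_re_le_norm _)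

/-- If `|b| ≤ |q|` or `|b| ≤ |p|`, divide the determinant by that entry. Otherwise `|p|, |q| < |b|`
and the determinant is at least `|b| (|b| - |p|)`, where `|b| - |p|` is `|p - b|` or `|p + b|`. -/
theorem enorm_div_det_real_le (p q b : ℝ) :
    ‖b‖ₑ / ‖p * q - b ^ 2‖ₑ ≤ ‖p - b ^ 2 / q‖ₑ⁻¹ + ‖q - b ^ 2 / p‖ₑ⁻¹ +
      (‖p - b‖ₑ⁻¹ + ‖p + b‖ₑ⁻¹) := by
  by_cases hb : b = 0
  · simp [hb]
  have key : ∀ p q : ℝ, |b| ≤ |q| → ‖b‖ₑ / ‖p * q - b ^ 2‖ₑ ≤ ‖p - b ^ 2 / q‖ₑ⁻¹ := by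
    intro p q hq
    have hq0 : q ≠ 0 := by
      rintro rfl
      exact hb (by simpa using hq)
    have h1 : p * q - b ^ 2 = q * (p - b ^ 2 / q) := by field_simp
    have hq' : ‖q‖ₑ ≠ 0 := by simpa using hq0
    rw [h1, enorm_mul, ENNReal.div_eq_inv_mul, ENNReal.mul_inv (.inl hq') (.inl enorm_ne_top),
      mul_comm ‖q‖ₑ⁻¹, mul_assoc]
    refine mul_le_of_le_one_right' ?_
    rw [← ENNReal.div_eq_inv_mul]
    refine ENNReal.div_le_of_le_mul ?_
    rw [one_mul, ← ofReal_norm, ← ofReal_norm]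
    exact ENNReal.ofReal_le_ofReal (by simpa using hq)
  rcases le_or_gt |b| |q| with hq | hq
  · exact (key p q hq).trans (le_add_right (le_add_right le_rfl))
  rcases le_or_gt |b| |p| with hp | hp
  · rw [mul_comm p q]
    exact (key q p hp).trans (le_add_right (le_add_left le_rfl))
  have hdet : |b| * (|b| - |p|) ≤ |p * q - b ^ 2| := by
    have h1 : p * q ≤ |p| * |b| := by
      calc p * q ≤ |p * q| := le_abs_self _
        _ = |p| * |q| := abs_mul _ _
        _ ≤ |p| * |b| := by gcongr
    have h2 : |b| ^ 2 = b ^ 2 := sq_abs b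
    rw [abs_sub_comm]
    refine le_trans ?_ (le_abs_self _)
    nlinarith
  have hmin : |p - b| = |b| - |p| ∨ |p + b| = |b| - |p| := by
    rcases abs_cases p with ⟨h1, _⟩ | ⟨h1, _⟩ <;> rcases abs_cases b with ⟨h2, _⟩ | ⟨h2, _⟩ <;>
      rw [h1, h2] at hp ⊢
    · left; rw [abs_of_neg (by linarith)]; ring
    · right; rw [abs_of_neg (by linarith)]; ring
    · right; rw [abs_of_pos (by linarith)]; ring
    · left; rw [abs_of_pos (by linarith)]; ring
  have hmain : ‖b‖ₑ / ‖p * q - b ^ 2‖ₑ ≤ (ENNReal.ofReal (|b| - |p|))⁻¹ := by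
    have hb' : 0 < |b| := abs_pos.2 hb
    have h3 : 0 < |b| - |p| := by linarith
    rw [← ofReal_norm b, ← ofReal_norm (p * q - b ^ 2), Real.norm_eq_abs, Real.norm_eq_abs,
      ← ENNReal.ofReal_div_of_pos (lt_of_lt_of_le (by positivity) hdet),
      ← ENNReal.ofReal_inv_of_pos h3]
    refine ENNReal.ofReal_le_ofReal ?_
    rw [inv_eq_one_div, div_le_div_iff₀ (lt_of_lt_of_le (by positivity) hdet) h3]
    linarith
  refine hmain.trans (le_add_left ?_)
  rcases hmin with h | h
  · rw [← h, ← Real.norm_eq_abs, ofReal_norm]; exact le_add_right le_rfl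
  · rw [← h, ← Real.norm_eq_abs, ofReal_norm]; exact le_add_left le_rfl

/-- Each term on the right is an inverse distance of `Re p` or `Re q` from a quantity not involving
that same entry, ready for integration in one variable. Since `(Im b)² ≤ |p| |q|`, one has `|b| ≤
|p| + |q| + |Re b|`. The first two summands cancel against a factor of the determinant; for the
third the determinant is replaced by that of the real parts. -/
theorem enorm_div_det_le {p q b : ℂ} (h0 : p * q - b ^ 2 ≠ 0) (h : b.im ^ 2 ≤ p.im * q.im) :
    ‖b / (p * q - b ^ 2)‖ₑ ≤
      (‖(p - b ^ 2 / q).re‖ₑ⁻¹ + ‖(q - b ^ 2 / p).re‖ₑ⁻¹) +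
      (‖p.re - b.re ^ 2 / q.re‖ₑ⁻¹ + ‖q.re - b.re ^ 2 / p.re‖ₑ⁻¹ +
        (‖p.re - b.re‖ₑ⁻¹ + ‖p.re + b.re‖ₑ⁻¹)) := by
  have h1 : ‖b / (p * q - b ^ 2)‖ₑ = ‖b‖ₑ / ‖p * q - b ^ 2‖ₑ := by
    rw [div_eq_mul_inv, enorm_mul, enorm_inv h0, div_eq_mul_inv]
  have h2 : ‖b‖ₑ ≤ (‖q‖ₑ + ‖p‖ₑ) + ‖b.re‖ₑ := by
    rw [← ofReal_norm, ← ofReal_norm, ← ofReal_norm, ← ofReal_norm,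
      ← ENNReal.ofReal_add (norm_nonneg _) (norm_nonneg _),
      ← ENNReal.ofReal_add (by positivity) (norm_nonneg _)]
    refine ENNReal.ofReal_le_ofReal ?_
    have h3 : |b.im| ≤ ‖q‖ + ‖p‖ := by
      refine abs_le_of_sq_le_sq ?_ (by positivity)
      have h4 : p.im * q.im ≤ ‖p‖ * ‖q‖ := by
        calc p.im * q.im ≤ |p.im * q.im| := le_abs_self _
          _ = |p.im| * |q.im| := abs_mul _ _
          _ ≤ ‖p‖ * ‖q‖ := by
            gcongr <;> exact Complex.abs_im_le_norm _
      nlinarith [norm_nonneg p, norm_nonneg q]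
    have := Complex.norm_le_abs_re_add_abs_im b
    rw [Real.norm_eq_abs]
    linarith
  rw [h1]
  refine (ENNReal.div_le_div_right h2 _).trans ?_
  rw [ENNReal.add_div, ENNReal.add_div]
  refine add_le_add (add_le_add (enorm_div_det_le_inv h0) ?_) ?_
  · rw [mul_comm p q] at h0 ⊢
    exact enorm_div_det_le_inv h0
  · refine le_trans (ENNReal.div_le_div_left ?_ _) (enorm_div_det_real_le _ _ _)
    rw [← ofReal_norm, ← ofReal_norm]
    refine ENNReal.ofReal_le_ofReal ?_
    rw [Real.norm_eq_abs]
    refine abs_le_of_sq_le_sq ?_ (norm_nonneg _)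
    rw [← Complex.normSq_eq_norm_sq]
    exact sq_re_det_le_normSq h

theorem lintegral_Icc_inv_rpow_lt_top {s : ℝ} (hs1 : s < 1) :
    ∫⁻ u in Set.Icc (-1 : ℝ) 1, (‖u‖ₑ⁻¹) ^ s < ∞ := by
  have h1 : ∫⁻ u in Set.Ioc (0 : ℝ) 1, (‖u‖ₑ⁻¹) ^ s < ∞ := by
    have h := (intervalIntegral.intervalIntegrable_rpow' (a := 0) (b := 1) (r := -s)
      (by linarith)).1.2
    rw [hasFiniteIntegral_iff_enorm] at h
    refine lt_of_le_of_lt (le_of_eq (setLIntegral_congr_fun measurableSet_Ioc fun u hu => ?_)) h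
    have hu0 : 0 < u := hu.1
    rw [← ofReal_norm, ← ofReal_norm, Real.norm_of_nonneg hu0.le,
      Real.norm_of_nonneg (by positivity), ← ENNReal.ofReal_inv_of_pos hu0,
      ENNReal.ofReal_rpow_of_pos (by positivity), Real.rpow_neg hu0.le, Real.inv_rpow hu0.le]
  have h2 : ∫⁻ u in Set.Ico (-1 : ℝ) 0, (‖u‖ₑ⁻¹) ^ s < ∞ := by
    have h := (Measure.measurePreserving_neg (volume : Measure ℝ)).setLIntegral_comp_preimage
      (s := Set.Ioc (0 : ℝ) 1) (f := fun u => (‖u‖ₑ⁻¹) ^ s) measurableSet_Ioc (by fun_prop)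
    simp only [enorm_neg] at h
    have h3 : (Neg.neg ⁻¹' Set.Ioc (0 : ℝ) 1) = Set.Ico (-1 : ℝ) 0 := by
      ext u; simp only [Set.mem_preimage, Set.mem_Ioc, Set.mem_Ico]
      constructor <;> rintro ⟨h, h'⟩ <;> constructor <;> linarith
    rw [h3] at h
    rw [h]; exact h1
  have h3 : ∫⁻ u in ({0} : Set ℝ), (‖u‖ₑ⁻¹) ^ s = 0 := by simp
  have hsub : Set.Icc (-1 : ℝ) 1 ⊆ (Set.Ico (-1 : ℝ) 0 ∪ {0}) ∪ Set.Ioc 0 1 := by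
    rintro u ⟨h, h'⟩
    rcases lt_trichotomy u 0 with h0 | h0 | h0
    · exact .inl (.inl ⟨h, h0⟩)
    · exact .inl (.inr h0)
    · exact .inr ⟨h0, h'⟩
  calc _ ≤ _ := lintegral_mono_set hsub
    _ ≤ _ := lintegral_union_le _ _ _
    _ ≤ _ := add_le_add_left (lintegral_union_le _ _ _) _
    _ < ∞ := by
      rw [h3, add_zero]
      exact ENNReal.add_lt_top.2 ⟨h2, h1⟩

/-- Where `|v + ζ| > 1` the integrand is at most 1; elsewhere the bounded density compares `ν` with
Lebesgue measure, whose translation invariance makes the bound uniform in `ζ`. -/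
theorem exists_lintegral_inv_rpow_le {ν : Measure ℝ} [IsProbabilityMeasure ν]
    (hν : IsRegularLaw ν) {s : ℝ} (hs0 : 0 < s) (hs1 : s < 1) :
    ∃ C : ℝ≥0∞, C ≠ ∞ ∧ ∀ ζ : ℝ, ∫⁻ v, (‖v + ζ‖ₑ⁻¹) ^ s ∂ν ≤ C := by
  obtain ⟨ρ, hρm, hρ0, ⟨M, hM⟩, -, hρ⟩ := hν
  have hle : ν ≤ ENNReal.ofReal M • (volume : Measure ℝ) := by
    rw [hρ, ← withDensity_const]
    exact withDensity_mono (Eventually.of_forall fun v => ENNReal.ofReal_le_ofReal (hM v))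
  refine ⟨1 + ENNReal.ofReal M * ∫⁻ u in Set.Icc (-1 : ℝ) 1, (‖u‖ₑ⁻¹) ^ s,
    ENNReal.add_ne_top.2 ⟨by simp, ENNReal.mul_ne_top (by simp)
      (lintegral_Icc_inv_rpow_lt_top hs1).ne⟩, fun ζ => ?_⟩
  have h1 : ∀ v : ℝ, (‖v + ζ‖ₑ⁻¹) ^ s ≤
      1 + (Set.Icc (-1 : ℝ) 1).indicator (fun u => (‖u‖ₑ⁻¹) ^ s) (v + ζ) := by
    intro v
    by_cases hv : v + ζ ∈ Set.Icc (-1 : ℝ) 1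
    · rw [Set.indicator_of_mem hv]; exact le_add_left le_rfl
    · rw [Set.indicator_of_notMem hv, add_zero]
      refine ENNReal.rpow_le_one ?_ hs0.le
      rw [ENNReal.inv_le_one, ← ofReal_norm, ← ENNReal.ofReal_one]
      refine ENNReal.ofReal_le_ofReal ?_
      by_contra hcon
      push Not at hcon
      exact hv (abs_le.1 hcon.le)
  have hm : Measurable ((Set.Icc (-1 : ℝ) 1).indicator fun u : ℝ => (‖u‖ₑ⁻¹) ^ s) :=
    Measurable.indicator (by fun_prop) measurableSet_Icc
  calc ∫⁻ v, (‖v + ζ‖ₑ⁻¹) ^ s ∂ν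
      ≤ ∫⁻ v, (1 + (Set.Icc (-1 : ℝ) 1).indicator (fun u => (‖u‖ₑ⁻¹) ^ s) (v + ζ)) ∂ν :=
        lintegral_mono h1
    _ = 1 + ∫⁻ v, (Set.Icc (-1 : ℝ) 1).indicator (fun u => (‖u‖ₑ⁻¹) ^ s) (v + ζ) ∂ν := by
        rw [lintegral_add_left measurable_const]; simp
    _ ≤ 1 + ∫⁻ v, (Set.Icc (-1 : ℝ) 1).indicator (fun u => (‖u‖ₑ⁻¹) ^ s) (v + ζ)
          ∂(ENNReal.ofReal M • (volume : Measure ℝ)) := by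
        gcongr
    _ = _ := by
        rw [lintegral_smul_measure, lintegral_add_right_eq_self
          (fun v => (Set.Icc (-1 : ℝ) 1).indicator (fun u => (‖u‖ₑ⁻¹) ^ s) v) ζ,
          lintegral_indicator measurableSet_Icc, smul_eq_mul]

theorem lintegral_green_update₂_le {d : ℕ} {ν : Measure ℝ} [IsProbabilityMeasure ν] {s : ℝ}
    (hs0 : 0 < s) (hs1 : s < 1) {C : ℝ≥0∞}
    (hC : ∀ ζ : ℝ, ∫⁻ v, (‖v + ζ‖ₑ⁻¹) ^ s ∂ν ≤ C) {lam : ℝ} (hlam : 0 < lam)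
    (V : Site d → ℝ) {W : Finset (Site d)} {z : ℂ} (hz : z.im ≠ 0) {x y : Site d} (hx : x ∈ W)
    (hy : y ∈ W) :
    ∫⁻ v, ∫⁻ w, ‖green lam (Function.update (Function.update V x v) y w) (W : Set (Site d)) z x y‖ₑ
      ^ s ∂ν ∂ν ≤ (‖lam‖ₑ⁻¹) ^ s * (6 * C) := by
  have hl : (lam : ℂ) ≠ 0 := by exact_mod_cast hlam.ne'
  have hle : ‖(lam : ℂ)‖ₑ = ‖lam‖ₑ := by
    rw [← ofReal_norm, ← ofReal_norm, Complex.norm_real]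
  by_cases hxy : x = y
  · subst hxy
    obtain ⟨a, ha⟩ := exists_green_update hlam.ne' V hz hx
    simp only [Function.update_idem, lintegral_const, measure_univ, mul_one]
    calc _ ≤ ∫⁻ w, (‖lam‖ₑ⁻¹) ^ s * (‖w + a.re‖ₑ⁻¹) ^ s ∂ν := by
          refine lintegral_mono fun w => ?_
          rw [(ha w).2, ← ENNReal.mul_rpow_of_nonneg _ _ hs0.le]
          refine ENNReal.rpow_le_rpow ?_ hs0.le
          rw [one_div, enorm_inv (mul_ne_zero hl (ha w).1), enorm_mul,
            ENNReal.mul_inv (.inl (by simpa using hlam.ne')) (.inl enorm_ne_top), hle]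
          gcongr
          rw [← ofReal_norm, ← ofReal_norm]
          refine ENNReal.ofReal_le_ofReal ?_
          simpa using Complex.abs_re_le_norm (w + a)
      _ ≤ _ := by
          rw [lintegral_const_mul _ (by fun_prop)]
          gcongr
          exact (hC _).trans (le_mul_of_one_le_left' (by norm_num))
  · obtain ⟨a, b, c, him, h⟩ := exists_green_update₂ hlam.ne' V hz hx hy hxy
    set F : ℝ → ℝ → ℝ≥0∞ := fun t ζ => (‖t + ζ‖ₑ⁻¹) ^ s with hF
    have hFm : Measurable (Function.uncurry F) := by fun_prop
    set f₁ : ℝ → ℝ := fun w => (a - b ^ 2 / (w + c)).re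
    set f₂ : ℝ → ℝ := fun v => (c - b ^ 2 / (v + a)).re
    set f₃ : ℝ → ℝ := fun w => a.re - b.re ^ 2 / (w + c.re)
    set f₄ : ℝ → ℝ := fun v => c.re - b.re ^ 2 / (v + a.re)
    have m₁ : Measurable f₁ := by fun_prop
    have m₂ : Measurable f₂ := by fun_prop
    have m₃ : Measurable f₃ := by fun_prop
    have m₄ : Measurable f₄ := by fun_prop
    have hadd : ∀ p q : ℝ≥0∞, (p + q) ^ s ≤ p ^ s + q ^ s := fun p q =>
      ENNReal.rpow_add_le_add_rpow p q hs0.le hs1.le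
    have hpt : ∀ v w : ℝ, ‖green lam (Function.update (Function.update V x v) y w)
        (W : Set (Site d)) z x y‖ₑ ^ s ≤ (‖lam‖ₑ⁻¹) ^ s * ((F v (f₁ w) + F w (f₂ v)) +
          (F v (f₃ w) + F w (f₄ v) + (F v (a.re - b.re) + F v (a.re + b.re)))) := by
      intro v w
      have e : b / (lam * ((v + a) * (w + c) - b ^ 2)) =
          (lam : ℂ)⁻¹ * (b / ((v + a) * (w + c) - b ^ 2)) := by
        field_simp [(h v w).1]
      rw [(h v w).2, e, enorm_mul, enorm_inv hl, hle, ENNReal.mul_rpow_of_nonneg _ _ hs0.le]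
      gcongr
      refine (ENNReal.rpow_le_rpow (enorm_div_det_le (h v w).1 (by simpa using him)) hs0.le).trans ?_
      refine (hadd _ _).trans (add_le_add ((hadd _ _).trans (le_of_eq ?_))
        ((hadd _ _).trans (add_le_add ((hadd _ _).trans (le_of_eq ?_))
          ((hadd _ _).trans (le_of_eq ?_)))))
      · simp only [hF, f₁, f₂, Complex.sub_re, Complex.add_re, Complex.ofReal_re, add_sub_assoc]
      · simp only [hF, f₃, f₄, Complex.add_re, Complex.ofReal_re, add_sub_assoc]
      · simp only [hF, Complex.add_re, Complex.ofReal_re, add_sub_assoc, add_assoc]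
    have hv : ∀ f : ℝ → ℝ, Measurable f → ∫⁻ v, ∫⁻ w, F v (f w) ∂ν ∂ν ≤ C := by
      intro f hf
      rw [lintegral_lintegral_swap (by fun_prop)]
      calc _ ≤ ∫⁻ _, C ∂ν := lintegral_mono fun w => hC (f w)
        _ = C := by simp
    have hw : ∀ f : ℝ → ℝ, ∫⁻ v, ∫⁻ w, F w (f v) ∂ν ∂ν ≤ C := by
      intro f
      calc _ ≤ ∫⁻ _, C ∂ν := lintegral_mono fun v => hC (f v)
        _ = C := by simp
    calc _ ≤ ∫⁻ v, ∫⁻ w, (‖lam‖ₑ⁻¹) ^ s * ((F v (f₁ w) + F w (f₂ v)) +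
          (F v (f₃ w) + F w (f₄ v) + (F v (a.re - b.re) + F v (a.re + b.re)))) ∂ν ∂ν :=
          lintegral_mono fun v => lintegral_mono fun w => hpt v w
      _ = (‖lam‖ₑ⁻¹) ^ s * (((∫⁻ v, ∫⁻ w, F v (f₁ w) ∂ν ∂ν) + ∫⁻ v, ∫⁻ w, F w (f₂ v) ∂ν ∂ν) +
          ((∫⁻ v, ∫⁻ w, F v (f₃ w) ∂ν ∂ν) + (∫⁻ v, ∫⁻ w, F w (f₄ v) ∂ν ∂ν) +
          ((∫⁻ v, ∫⁻ _, F v (a.re - b.re) ∂ν ∂ν) + ∫⁻ v, ∫⁻ _, F v (a.re + b.re) ∂ν ∂ν))) := by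
          have hi : ∀ v, ∫⁻ w, (‖lam‖ₑ⁻¹) ^ s * ((F v (f₁ w) + F w (f₂ v)) +
              (F v (f₃ w) + F w (f₄ v) + (F v (a.re - b.re) + F v (a.re + b.re)))) ∂ν =
              (‖lam‖ₑ⁻¹) ^ s * (((∫⁻ w, F v (f₁ w) ∂ν) + ∫⁻ w, F w (f₂ v) ∂ν) +
              ((∫⁻ w, F v (f₃ w) ∂ν) + (∫⁻ w, F w (f₄ v) ∂ν) +
              ((∫⁻ _, F v (a.re - b.re) ∂ν) + ∫⁻ _, F v (a.re + b.re) ∂ν))) := by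
            intro v
            rw [lintegral_const_mul _ (by fun_prop), lintegral_add_left (by fun_prop),
              lintegral_add_left (by fun_prop), lintegral_add_left (by fun_prop),
              lintegral_add_left (by fun_prop), lintegral_add_left (by fun_prop)]
          have n₁ : Measurable fun v => ∫⁻ w, F v (f₁ w) ∂ν :=
            Measurable.lintegral_prod_right' (f := fun p : ℝ × ℝ => F p.1 (f₁ p.2)) (by fun_prop)
          have n₂ : Measurable fun v => ∫⁻ w, F w (f₂ v) ∂ν :=
            Measurable.lintegral_prod_right' (f := fun p : ℝ × ℝ => F p.2 (f₂ p.1)) (by fun_prop)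
          have n₃ : Measurable fun v => ∫⁻ w, F v (f₃ w) ∂ν :=
            Measurable.lintegral_prod_right' (f := fun p : ℝ × ℝ => F p.1 (f₃ p.2)) (by fun_prop)
          have n₄ : Measurable fun v => ∫⁻ w, F w (f₄ v) ∂ν :=
            Measurable.lintegral_prod_right' (f := fun p : ℝ × ℝ => F p.2 (f₄ p.1)) (by fun_prop)
          have n₅ : ∀ t : ℝ, Measurable fun v => ∫⁻ _, F v t ∂ν := fun t =>
            Measurable.lintegral_prod_right' (f := fun p : ℝ × ℝ => F p.1 t) (by fun_prop)
          have n₆ := n₅ (a.re - b.re)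
          have n₇ := n₅ (a.re + b.re)
          simp only [hi]
          rw [lintegral_const_mul _ (by fun_prop), lintegral_add_left (by fun_prop),
              lintegral_add_left (by fun_prop), lintegral_add_left (by fun_prop),
              lintegral_add_left (by fun_prop), lintegral_add_left (by fun_prop)]
      _ ≤ (‖lam‖ₑ⁻¹) ^ s * ((C + C) + (C + C + (C + C))) := by
          gcongr
          · exact hv _ m₁
          · exact hw _
          · exact hv _ m₃
          · exact hw _
          · exact hv (fun _ => a.re - b.re) measurable_const
          · exact hv (fun _ => a.re + b.re) measurable_const
      _ = _ := by ring

/-! ### The product law of the potential -/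

theorem measurableSet_resolvent {d : ℕ} (lam : ℝ) (W : Finset (Site d)) (z : ℂ) :
    MeasurableSet {V : Site d → ℝ | Resolvent lam V (W : Set (Site d)) z} :=
  ((isOpen_resolvent_and_continuousOn_green lam W 0 0).1.preimage
    (f := fun V : Site d → ℝ => (V, z)) (by fun_prop)).measurableSet

/-- Continuous on the open set of potentials for which `z` is in the resolvent set; off that set
`Ring.inverse` takes its default value 0. -/
theorem measurable_green {d : ℕ} (lam : ℝ) (W : Finset (Site d)) (z : ℂ) (x y : Site d) :
    Measurable fun V : Site d → ℝ => green lam V (W : Set (Site d)) z x y := by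
  classical
  set U := {V : Site d → ℝ | Resolvent lam V (W : Set (Site d)) z} with hU
  have hc : ContinuousOn (fun V : Site d → ℝ => green lam V (W : Set (Site d)) z x y) U := by
    intro V hV
    have h := (isOpen_resolvent_and_continuousOn_green lam W x y).2 (V, z) hV
    exact (ContinuousAt.comp (f := fun V : Site d → ℝ => (V, z)) h
      (by fun_prop : Continuous fun V : Site d → ℝ => (V, z)).continuousAt).continuousWithinAt
  have h := hc.measurable_piecewise (g := fun _ => (0 : ℂ)) continuousOn_const
    (measurableSet_resolvent lam W z)
  convert h using 1
  funext V
  by_cases hV : V ∈ U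
  · rw [Set.piecewise_eq_of_mem _ _ _ hV]
  · rw [Set.piecewise_eq_of_notMem _ _ _ hV]
    have : Ring.inverse (ham lam V (W : Set (Site d)) -
        z • (1 : L2 (W : Set (Site d)) →L[ℂ] L2 (W : Set (Site d)))) = 0 :=
      Ring.inverse_non_unit _ hV
    simp [green, this]

/-- The law of an i.i.d. potential with single-site law `ν`. -/
noncomputable def potLaw (d : ℕ) (ν : Measure ℝ) : Measure (Site d → ℝ) :=
  Measure.infinitePi fun _ => ν

instance {d : ℕ} {ν : Measure ℝ} [IsProbabilityMeasure ν] : IsProbabilityMeasure (potLaw d ν) := by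
  unfold potLaw; infer_instance

theorem IsIIDPotential.map_eq_potLaw {d : ℕ} {S : Type*} [MeasurableSpace S] {P : Measure S}
    [IsProbabilityMeasure P] {V : Site d → S → ℝ} {ν : Measure ℝ} (h : IsIIDPotential P V ν) :
    P.map (fun ω a => V a ω) = potLaw d ν := by
  rw [(iIndepFun_iff_map_fun_eq_infinitePi_map h.measurable).1 h.indep]
  simp only [h.map_eq, potLaw]

theorem isIIDPotential_potLaw {d : ℕ} {ν : Measure ℝ} [IsProbabilityMeasure ν] :
    IsIIDPotential (potLaw d ν) (fun a V => V a) ν where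
  measurable a := measurable_pi_apply a
  map_eq a := (measurePreserving_eval_infinitePi (fun _ : Site d => ν) a).map_eq
  indep := iIndepFun_infinitePi (P := fun _ : Site d => ν) (X := fun _ => id) fun _ => measurable_id

theorem measurable_update_pair {d : ℕ} (a : Site d) :
    Measurable fun p : (Site d → ℝ) × ℝ => Function.update p.1 a p.2 := by
  refine measurable_pi_lambda _ fun b => ?_
  by_cases hb : b = a
  · subst hb; simpa using measurable_snd
  · simp only [Function.update_of_ne hb]
    exact (measurable_pi_apply b).comp measurable_fst

/-- Resampling one coordinate independently preserves the product law. This is how conditioning on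
all other sites is expressed. -/
theorem map_update_potLaw {d : ℕ} {ν : Measure ℝ} [IsProbabilityMeasure ν] (a : Site d) :
    ((potLaw d ν).prod ν).map (fun p => Function.update p.1 a p.2) = potLaw d ν := by
  classical
  refine Measure.eq_infinitePi _ fun s t ht => ?_
  have hpi : ∀ s : Finset (Site d), MeasurableSet ((s : Set (Site d)).pi t) := fun s =>
    MeasurableSet.pi s.countable_toSet fun b _ => ht b
  rw [Measure.map_apply (measurable_update_pair a) (hpi s)]
  have e : (fun p : (Site d → ℝ) × ℝ => Function.update p.1 a p.2) ⁻¹' (s : Set (Site d)).pi t =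
      ((s.erase a : Finset (Site d)) : Set (Site d)).pi t ×ˢ
        (if a ∈ s then t a else Set.univ) := by
    ext p
    simp only [Set.mem_preimage, Set.mem_pi, Finset.mem_coe, Set.mem_prod, Finset.mem_erase]
    constructor
    · intro h
      refine ⟨fun b hb => by simpa [hb.1] using h b hb.2, ?_⟩
      split_ifs with ha
      · simpa using h a ha
      · trivial
    · rintro ⟨h1, h2⟩ b hb
      by_cases hba : b = a
      · subst hba; simpa [hb] using h2
      · simpa [hba] using h1 b ⟨hba, hb⟩
  rw [e, Measure.prod_prod, potLaw, Measure.infinitePi_pi _ fun b _ => ht b]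
  split_ifs with ha
  · rw [mul_comm, Finset.mul_prod_erase s (fun b => ν (t b)) ha]
  · simp [Finset.erase_eq_of_notMem ha]

theorem lintegral_potLaw_update {d : ℕ} {ν : Measure ℝ} [IsProbabilityMeasure ν] (a : Site d)
    {F : (Site d → ℝ) → ℝ≥0∞} (hF : Measurable F) :
    ∫⁻ V, F V ∂potLaw d ν = ∫⁻ V, ∫⁻ t, F (Function.update V a t) ∂ν ∂potLaw d ν := by
  conv_lhs => rw [← map_update_potLaw (d := d) (ν := ν) a]
  rw [lintegral_map hF (measurable_update_pair a),
    lintegral_prod (fun p => F (Function.update p.1 a p.2))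
      (hF.comp (measurable_update_pair a)).aemeasurable]

theorem lintegral_potLaw_update₂ {d : ℕ} {ν : Measure ℝ} [IsProbabilityMeasure ν] (a b : Site d)
    {F : (Site d → ℝ) → ℝ≥0∞} (hF : Measurable F) :
    ∫⁻ V, F V ∂potLaw d ν =
      ∫⁻ V, ∫⁻ v, ∫⁻ w, F (Function.update (Function.update V a v) b w) ∂ν ∂ν ∂potLaw d ν := by
  rw [lintegral_potLaw_update b hF, lintegral_potLaw_update a]
  exact Measurable.lintegral_prod_right' (f := fun p : (Site d → ℝ) × ℝ =>
    F (Function.update p.1 b p.2)) (hF.comp (measurable_update_pair b))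

theorem lintegral_potLaw_mul {d : ℕ} {ν : Measure ℝ} [IsProbabilityMeasure ν]
    {A B : Finset (Site d)} (hAB : Disjoint A B) {F G : (Site d → ℝ) → ℝ≥0∞} (hF : Measurable F)
    (hG : Measurable G) (hFA : ∀ V V', (∀ a ∈ A, V a = V' a) → F V = F V')
    (hGB : ∀ V V', (∀ a ∈ B, V a = V' a) → G V = G V') :
    ∫⁻ V, F V * G V ∂potLaw d ν = (∫⁻ V, F V ∂potLaw d ν) * ∫⁻ V, G V ∂potLaw d ν := by
  classical
  have hi := (isIIDPotential_potLaw (d := d) (ν := ν)).indep.indepFun_finset A B hAB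
    fun a => measurable_pi_apply a
  set ext : (T : Finset (Site d)) → (T → ℝ) → Site d → ℝ := fun T r a =>
    if h : a ∈ T then r ⟨a, h⟩ else 0 with hext
  have hm : ∀ T, Measurable (ext T) := fun T => by
    refine measurable_pi_lambda _ fun a => ?_
    by_cases h : a ∈ T
    · simpa [hext, h] using measurable_pi_apply _
    · simp [hext, h]
  have h := lintegral_mul_eq_lintegral_mul_lintegral_of_indepFun
    ((hF.comp (hm A)).comp (measurable_pi_lambda _ fun a : A => measurable_pi_apply a.1))
    ((hG.comp (hm B)).comp (measurable_pi_lambda _ fun a : B => measurable_pi_apply a.1))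
    (hi.comp (hF.comp (hm A)) (hG.comp (hm B)))
  have e1 : ∀ V, F (ext A fun a : A => V a.1) = F V := fun V => hFA _ _ fun a ha => by
    simp [hext, ha]
  have e2 : ∀ V, G (ext B fun a : B => V a.1) = G V := fun V => hGB _ _ fun a ha => by
    simp [hext, ha]
  simpa [Function.comp_def, e1, e2] using h

/-- The fractional moment under the product law. -/
noncomputable def moment {d : ℕ} (ν : Measure ℝ) (lam s : ℝ) (Ω : Set (Site d)) (z : ℂ)
    (x y : Site d) : ℝ≥0∞ :=
  ∫⁻ V, ‖green lam V Ω z x y‖ₑ ^ s ∂potLaw d ν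

theorem measurable_enorm_green_rpow {d : ℕ} (lam s : ℝ) (W : Finset (Site d)) (z : ℂ)
    (x y : Site d) :
    Measurable fun V : Site d → ℝ => ‖green lam V (W : Set (Site d)) z x y‖ₑ ^ s :=
  (measurable_green lam W z x y).enorm.pow_const s

theorem IsIIDPotential.greenMoment_eq {d : ℕ} {S : Type*} [MeasurableSpace S] {P : Measure S}
    [IsProbabilityMeasure P] {V : Site d → S → ℝ} {ν : Measure ℝ} (h : IsIIDPotential P V ν)
    (lam s : ℝ) {Ω : Set (Site d)} {z : ℂ} {x y : Site d}
    (hm : AEMeasurable (fun V : Site d → ℝ => ‖green lam V Ω z x y‖ₑ ^ s) (potLaw d ν)) :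
    greenMoment P V lam s Ω z x y = moment ν lam s Ω z x y := by
  rw [moment, ← h.map_eq_potLaw, lintegral_map' (by rwa [h.map_eq_potLaw])
    (measurable_pi_lambda _ h.measurable).aemeasurable]
  rfl

theorem moment_eq_zero_left {d : ℕ} {ν : Measure ℝ} {lam s : ℝ} (hs : 0 < s) {Ω : Set (Site d)}
    {z : ℂ} {x y : Site d} (hx : x ∉ Ω) : moment ν lam s Ω z x y = 0 := by
  simp [moment, green_eq_zero_left hx, hs]

/-! ### Translation invariance -/

/-- Translation of a finite region by `-a`. -/
def translate {d : ℕ} (a : Site d) (W : Finset (Site d)) : Finset (Site d) :=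
  W.map (Equiv.subRight a).toEmbedding

theorem mem_translate {d : ℕ} {a x : Site d} {W : Finset (Site d)} :
    x ∈ translate a W ↔ x + a ∈ W := by
  simp [translate]

theorem green_translate {d : ℕ} (lam : ℝ) (V : Site d → ℝ) (W : Finset (Site d)) {z : ℂ}
    (hz : z.im ≠ 0) (a x y : Site d) :
    green lam (fun b => V (b + a)) (translate a W : Set (Site d)) z (x - a) (y - a) =
      green lam V (W : Set (Site d)) z x y := by
  classical
  by_cases hy : y ∈ W
  swap
  · rw [green_eq_zero_right (y := y - a) (by simpa [mem_translate] using hy),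
      green_eq_zero_right (y := y) (by simpa using hy)]
  have h := eq_green_of_diffOp (lam := lam) (V := fun b => V (b + a))
    (resolvent_of_im_ne_zero lam (fun b => V (b + a)) (translate a W : Set (Site d)) hz)
    (g := fun b => green lam V (W : Set (Site d)) z (b + a) y) (y := y - a)
    (by simpa [mem_translate]) (fun b hb => green_eq_zero_left (by simpa [mem_translate] using hb))
    (fun u hu => ?_) (x - a)
  · rw [← h]; simp
  · rw [mem_translate] at hu
    have h1 := diffOp_green (boundedOn_finset V W)
      (resolvent_of_im_ne_zero lam V (W : Set (Site d)) hz) (x := u + a) (y := y)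
      (by simpa using hu) (by simpa using hy)
    have h2 : (if u = y - a then (1 : ℂ) else 0) = if u + a = y then 1 else 0 := by
      simp only [eq_sub_iff_add_eq]
    rw [h2, ← h1]
    simp only [diffOp]
    congr 1
    refine Finset.sum_bij (fun b _ => b + a) (fun b hb => mem_nbrs_add.2 hb)
      (fun b _ c _ h => add_right_cancel h) (fun b hb => ⟨b - a, ?_, by simp⟩) (fun b _ => rfl)
    rw [← mem_nbrs_add (a := a)]
    simpa using hb

theorem moment_translate {d : ℕ} {ν : Measure ℝ} [IsProbabilityMeasure ν] (lam s : ℝ)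
    (W : Finset (Site d)) {z : ℂ} (hz : z.im ≠ 0) (a x y : Site d) :
    moment ν lam s (translate a W : Set (Site d)) z (x - a) (y - a) =
      moment ν lam s (W : Set (Site d)) z x y := by
  have hiid : IsIIDPotential (potLaw d ν) (fun b V => V (b + a)) ν :=
    { measurable := fun b => measurable_pi_apply _
      map_eq := fun b => isIIDPotential_potLaw.map_eq (b + a)
      indep := isIIDPotential_potLaw.indep.precomp (add_left_injective a) }
  rw [← hiid.greenMoment_eq lam s (measurable_enorm_green_rpow _ _ _ _ _ _).aemeasurable,
    greenMoment, moment]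
  simp only [green_translate lam _ W hz]

/-! ### The a priori bound and the decoupling inequality -/

/-- `K` bounds the conditional fractional moments of finite-volume Green functions off the
real axis, given the potential away from the two endpoints. -/
def AprioriBound (d : ℕ) (ν : Measure ℝ) (lam s : ℝ) (K : ℝ≥0∞) : Prop :=
  ∀ (V : Site d → ℝ) (W : Finset (Site d)) (z : ℂ), z.im ≠ 0 → ∀ x y : Site d,
    ∫⁻ v, ∫⁻ w, ‖green lam (Function.update (Function.update V x v) y w) (W : Set (Site d)) z x y‖ₑ
      ^ s ∂ν ∂ν ≤ K

theorem exists_aprioriBound (d : ℕ) {ν : Measure ℝ} [IsProbabilityMeasure ν]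
    (hν : IsRegularLaw ν) {s : ℝ} (hs0 : 0 < s) (hs1 : s < 1) :
    ∃ C : ℝ, 0 < C ∧ ∀ lam : ℝ, 0 < lam →
      AprioriBound d ν lam s (ENNReal.ofReal (C / lam ^ s)) := by
  obtain ⟨C, hCtop, hC⟩ := exists_lintegral_inv_rpow_le hν hs0 hs1
  refine ⟨(6 * C).toReal + 1, by positivity, fun lam hlam V W z hz x y => ?_⟩
  by_cases hx : x ∈ W
  swap
  · simp [green_eq_zero_left (Ω := (W : Set (Site d))) (x := x) (by simpa using hx), hs0]
  by_cases hy : y ∈ W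
  swap
  · simp [green_eq_zero_right (Ω := (W : Set (Site d))) (y := y) (by simpa using hy), hs0]
  refine (lintegral_green_update₂_le hs0 hs1 hC hlam V hz hx hy).trans ?_
  have h6 : 6 * C ≠ ∞ := ENNReal.mul_ne_top (by norm_num) hCtop
  rw [← ofReal_norm, Real.norm_of_nonneg hlam.le, ← ENNReal.ofReal_inv_of_pos hlam,
    ENNReal.ofReal_rpow_of_pos (by positivity), div_eq_inv_mul, ← Real.inv_rpow hlam.le,
    ENNReal.ofReal_mul (by positivity)]
  gcongr
  refine (ENNReal.ofReal_toReal h6).symm.le.trans (ENNReal.ofReal_le_ofReal (by linarith))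

theorem AprioriBound.moment_le {d : ℕ} {ν : Measure ℝ} [IsProbabilityMeasure ν] {lam s : ℝ}
    {K : ℝ≥0∞} (hK : AprioriBound d ν lam s K) (W : Finset (Site d)) {z : ℂ} (hz : z.im ≠ 0)
    (x y : Site d) : moment ν lam s (W : Set (Site d)) z x y ≤ K := by
  rw [moment, lintegral_potLaw_update₂ x y (measurable_enorm_green_rpow _ _ _ _ _ _)]
  calc _ ≤ ∫⁻ _, K ∂potLaw d ν := lintegral_mono fun V => hK V W z hz x y
    _ = K := by simp

/-- Geometric resolvent identity for `R ∩ A` inside `R`; the direct term vanishes as `y ∉ A`. A bond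
leaving `R ∩ A` counts only if its outer end is in `R`, and then it is a bond of `A`, so the sum
runs over bonds that do not depend on `R`. -/
theorem enorm_green_le_sum_inner {d : ℕ} {lam : ℝ} {V : Site d → ℝ} {z : ℂ} (hz : z.im ≠ 0)
    [DecidableEq (Site d)] (R A : Finset (Site d)) {x y : Site d} (hx : x ∈ A) (hy : y ∉ A) :
    ‖green lam V (R : Set (Site d)) z x y‖ₑ ≤ ∑ b ∈ boundaryBonds A,
      ‖green lam V (R ∩ A : Finset (Site d)) z x b.1‖ₑ * ‖green lam V (R : Set (Site d)) z b.2 y‖ₑ := by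
  by_cases hxR : x ∈ R
  swap
  · rw [green_eq_zero_left (by simpa)]; simp
  by_cases hyR : y ∈ R
  swap
  · rw [green_eq_zero_right (by simpa)]; simp
  rw [green_eq_add_boundary (W := R ∩ A) (boundedOn_finset V R)
    (resolvent_of_im_ne_zero lam V _ hz) (resolvent_of_im_ne_zero lam V _ hz)
    (by intro a ha; exact (Finset.mem_inter.1 ha).1) (by simp [hx, hxR]) (by simpa using hyR),
    green_eq_zero_right (y := y) (by simp [hy]), zero_add]
  refine (enorm_sum_le _ _).trans ?_
  simp only [enorm_mul]
  refine Finset.sum_le_sum_of_ne_zero fun b hb hne => ?_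
  rw [mem_boundaryBonds] at hb ⊢
  have hb2 : b.2 ∈ R := by
    by_contra h
    exact hne (by rw [green_eq_zero_left (x := b.2) (by simpa using h)]; simp)
  rw [Finset.mem_inter, Finset.mem_inter] at hb
  exact ⟨hb.1.2, hb.2.1, fun h => hb.2.2 ⟨hb2, h⟩⟩

/-- The same expansion started from `y` in the region `R ∖ B`, using the symmetry of the Green
function; its contributing bonds, reversed, are bonds of `B`. -/
theorem enorm_green_le_sum_outer {d : ℕ} {lam : ℝ} {V : Site d → ℝ} {z : ℂ} (hz : z.im ≠ 0)
    [DecidableEq (Site d)] (R B : Finset (Site d)) {u y : Site d} (hu : u ∈ B) (hy : y ∉ B) :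
    ‖green lam V (R : Set (Site d)) z u y‖ₑ ≤ ∑ c ∈ boundaryBonds B,
      ‖green lam V (R : Set (Site d)) z u c.1‖ₑ * ‖green lam V (R \ B : Finset (Site d)) z c.2 y‖ₑ := by
  by_cases huR : u ∈ R
  swap
  · rw [green_eq_zero_left (by simpa)]; simp
  by_cases hyR : y ∈ R
  swap
  · rw [green_eq_zero_right (by simpa)]; simp
  have hR := resolvent_of_im_ne_zero lam V (R : Set (Site d)) hz
  have hR' := resolvent_of_im_ne_zero lam V ((R \ B : Finset (Site d)) : Set (Site d)) hz
  rw [green_symm hR, green_eq_add_boundary (W := R \ B) (boundedOn_finset V R) hR' hR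
    (by intro a ha; exact (Finset.mem_sdiff.1 ha).1) (by simp [hy, hyR]) (by simpa using huR),
    green_eq_zero_right (y := u) (by simp [hu]), zero_add]
  refine (enorm_sum_le _ _).trans ?_
  simp only [enorm_mul, green_symm hR' y, green_symm hR _ u]
  have hswap : ∀ b ∈ boundaryBonds (R \ B), b.2 ∈ R → b.swap ∈ boundaryBonds B := by
    intro b hb hb2
    rw [mem_boundaryBonds, Finset.mem_sdiff, Finset.mem_sdiff] at hb
    rw [mem_boundaryBonds]
    exact ⟨by by_contra h; exact hb.2.2 ⟨hb2, h⟩, mem_nbrs_comm.1 hb.2.1, hb.1.2⟩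
  rw [← Finset.sum_map (boundaryBonds (R \ B)) (Equiv.prodComm _ _).toEmbedding
    (fun c => ‖green lam V (R : Set (Site d)) z u c.1‖ₑ *
      ‖green lam V (R \ B : Finset (Site d)) z c.2 y‖ₑ) |>.trans
      (Finset.sum_congr rfl fun b _ => by simp [mul_comm])]
  refine Finset.sum_le_sum_of_ne_zero fun c hc hne => ?_
  obtain ⟨b, hb, rfl⟩ := Finset.mem_map.1 hc
  refine hswap b hb ?_
  by_contra h
  exact hne (by
    rw [green_eq_zero_right (Ω := (R : Set (Site d))) (y := ((Equiv.prodComm _ _).toEmbedding b).1)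
      (by simpa using h)]
    simp)

theorem rpow_sum_le_sum_rpow {ι : Type*} (t : Finset ι) (f : ι → ℝ≥0∞) {s : ℝ} (hs0 : 0 < s)
    (hs1 : s ≤ 1) : (∑ i ∈ t, f i) ^ s ≤ ∑ i ∈ t, f i ^ s := by
  classical
  induction t using Finset.induction_on with
  | empty => simp [hs0]
  | insert a t ha ih =>
    rw [Finset.sum_insert ha, Finset.sum_insert ha]
    exact (ENNReal.rpow_add_le_add_rpow _ _ hs0.le hs1).trans (add_le_add_right ih _)

theorem subset_fatten {d : ℕ} (Λ : Finset (Site d)) : Λ ⊆ fatten Λ := Finset.subset_union_left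

theorem mem_fatten_of_mem_nbrs {d : ℕ} {Λ : Finset (Site d)} {u v : Site d} (hu : u ∈ Λ)
    (hv : v ∈ nbrs u) : v ∈ fatten Λ :=
  Finset.mem_union_right _ (Finset.mem_biUnion.2 ⟨u, hu, hv⟩)

/-- Resample the sites `u` and `v` first: `F` and `H` do not see them and `G` averages to at most
`K`. Afterwards `F` and `H` depend on disjoint sets of sites and factorize. -/
theorem lintegral_potLaw_mul_mul_le {d : ℕ} {ν : Measure ℝ} [IsProbabilityMeasure ν]
    {A B : Finset (Site d)} (hAB : Disjoint A B) {u v : Site d} (hu : u ∉ A ∧ u ∉ B)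
    (hv : v ∉ A ∧ v ∉ B) {F G H : (Site d → ℝ) → ℝ≥0∞} (hF : Measurable F) (hG : Measurable G)
    (hH : Measurable H) (hFA : ∀ V V', (∀ a ∈ A, V a = V' a) → F V = F V')
    (hHB : ∀ V V', (∀ a ∈ B, V a = V' a) → H V = H V') {K : ℝ≥0∞}
    (hK : ∀ V, ∫⁻ t, ∫⁻ w, G (Function.update (Function.update V u t) v w) ∂ν ∂ν ≤ K) :
    ∫⁻ V, F V * (G V * H V) ∂potLaw d ν ≤
      (∫⁻ V, F V ∂potLaw d ν) * (K * ∫⁻ V, H V ∂potLaw d ν) := by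
  have hupd : ∀ T : Finset (Site d), u ∉ T → v ∉ T → ∀ (V : Site d → ℝ) (t w : ℝ), ∀ c ∈ T,
      Function.update (Function.update V u t) v w c = V c := by
    intro T huT hvT V t w c hc
    rw [Function.update_of_ne (by rintro rfl; exact hvT hc),
      Function.update_of_ne (by rintro rfl; exact huT hc)]
  have m1 : ∀ V, Measurable fun p : ℝ × ℝ => G (Function.update (Function.update V u p.1) v p.2) :=
    fun V => hG.comp ((measurable_update_pair v).comp (((measurable_update_pair u).comp
      (measurable_const.prodMk measurable_fst)).prodMk measurable_snd))
  rw [lintegral_potLaw_update₂ u v (F := fun V => F V * (G V * H V)) (by fun_prop)]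
  have hpt : ∀ V, ∫⁻ t, ∫⁻ w, F (Function.update (Function.update V u t) v w) *
      (G (Function.update (Function.update V u t) v w) *
        H (Function.update (Function.update V u t) v w)) ∂ν ∂ν ≤ K * (F V * H V) := by
    intro V
    have e : ∀ t, ∫⁻ w, F (Function.update (Function.update V u t) v w) *
        (G (Function.update (Function.update V u t) v w) *
          H (Function.update (Function.update V u t) v w)) ∂ν =
        (F V * H V) * ∫⁻ w, G (Function.update (Function.update V u t) v w) ∂ν := by
      intro t
      have m2 : Measurable fun w => G (Function.update (Function.update V u t) v w) :=
        (m1 V).comp measurable_prodMk_left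
      rw [← lintegral_const_mul _ m2]
      refine lintegral_congr fun w => ?_
      rw [hFA _ V (hupd A hu.1 hv.1 V t w), hHB _ V (hupd B hu.2 hv.2 V t w)]
      ring
    simp only [e]
    rw [lintegral_const_mul _ (m1 V).lintegral_prod_right', mul_comm]
    exact mul_le_mul_left (hK V) _
  refine (lintegral_mono hpt).trans (le_of_eq ?_)
  rw [lintegral_const_mul _ (by fun_prop), lintegral_potLaw_mul hAB hF hH hFA hHB]
  ring

theorem AprioriBound.lintegral_mul_mul_le {d : ℕ} {ν : Measure ℝ} [IsProbabilityMeasure ν]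
    {lam s : ℝ} {K : ℝ≥0∞} (hK : AprioriBound d ν lam s K) {z : ℂ} (hz : z.im ≠ 0)
    {R A B : Finset (Site d)} (hAB : Disjoint A B) {u v : Site d}
    (hu : u ∉ A ∧ u ∉ B) (hv : v ∉ A ∧ v ∉ B) (x a b y : Site d) :
    ∫⁻ V, ‖green lam V (A : Set (Site d)) z x a‖ₑ ^ s *
      (‖green lam V (R : Set (Site d)) z u v‖ₑ ^ s * ‖green lam V (B : Set (Site d)) z b y‖ₑ ^ s)
      ∂potLaw d ν ≤
    moment ν lam s (A : Set (Site d)) z x a * (K * moment ν lam s (B : Set (Site d)) z b y) :=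
  lintegral_potLaw_mul_mul_le hAB hu hv (measurable_enorm_green_rpow lam s A z x a)
    (measurable_enorm_green_rpow lam s R z u v) (measurable_enorm_green_rpow lam s B z b y)
    (fun V V' h => by rw [green_congr (Ω := (A : Set (Site d))) h])
    (fun V V' h => by rw [green_congr (Ω := (B : Set (Site d))) h])
    (fun V => hK V R z hz u v)

theorem AprioriBound.moment_le_sum {d : ℕ} {ν : Measure ℝ} [IsProbabilityMeasure ν]
    [DecidableEq (Site d)] {lam s : ℝ} (hs0 : 0 < s) (hs1 : s ≤ 1) {K : ℝ≥0∞}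
    (hK : AprioriBound d ν lam s K) {z : ℂ} (hz : z.im ≠ 0) (R Λ : Finset (Site d)) {x y : Site d}
    (hx : x ∈ Λ) (hy : y ∉ fatten Λ) :
    moment ν lam s (R : Set (Site d)) z x y ≤
      (∑ b ∈ boundaryBonds Λ, moment ν lam s (R ∩ Λ : Finset (Site d)) z x b.1) *
        (K * ∑ c ∈ boundaryBonds (fatten Λ),
          moment ν lam s (R \ fatten Λ : Finset (Site d)) z c.2 y) := by
  set A := R ∩ Λ
  set B := R \ fatten Λ
  have hAB : Disjoint A B := by
    rw [Finset.disjoint_left]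
    intro a ha hb
    exact (Finset.mem_sdiff.1 hb).2 (subset_fatten Λ (Finset.mem_inter.1 ha).2)
  have mA := fun a => measurable_enorm_green_rpow lam s A z x a
  have mR := fun u v => measurable_enorm_green_rpow lam s R z u v
  have mB := fun b => measurable_enorm_green_rpow lam s B z b y
  have hpt : ∀ V : Site d → ℝ, ‖green lam V (R : Set (Site d)) z x y‖ₑ ^ s ≤
      ∑ b ∈ boundaryBonds Λ, ∑ c ∈ boundaryBonds (fatten Λ),
        ‖green lam V (A : Set (Site d)) z x b.1‖ₑ ^ s *
          (‖green lam V (R : Set (Site d)) z b.2 c.1‖ₑ ^ s *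
            ‖green lam V (B : Set (Site d)) z c.2 y‖ₑ ^ s) := by
    intro V
    refine (ENNReal.rpow_le_rpow (enorm_green_le_sum_inner hz R Λ hx
      fun h => hy (subset_fatten Λ h)) hs0.le).trans ((rpow_sum_le_sum_rpow _ _ hs0 hs1).trans ?_)
    refine Finset.sum_le_sum fun b hb => ?_
    rw [mem_boundaryBonds] at hb
    rw [ENNReal.mul_rpow_of_nonneg _ _ hs0.le, ← Finset.mul_sum]
    gcongr
    refine (ENNReal.rpow_le_rpow (enorm_green_le_sum_outer hz R (fatten Λ)
      (mem_fatten_of_mem_nbrs hb.1 hb.2.1) hy) hs0.le).trans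
      ((rpow_sum_le_sum_rpow _ _ hs0 hs1).trans ?_)
    simp only [ENNReal.mul_rpow_of_nonneg _ _ hs0.le]
    exact le_rfl
  calc _ ≤ ∫⁻ V, ∑ b ∈ boundaryBonds Λ, ∑ c ∈ boundaryBonds (fatten Λ),
        ‖green lam V (A : Set (Site d)) z x b.1‖ₑ ^ s *
          (‖green lam V (R : Set (Site d)) z b.2 c.1‖ₑ ^ s *
            ‖green lam V (B : Set (Site d)) z c.2 y‖ₑ ^ s) ∂potLaw d ν := lintegral_mono hpt
    _ = ∑ b ∈ boundaryBonds Λ, ∑ c ∈ boundaryBonds (fatten Λ), ∫⁻ V,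
        ‖green lam V (A : Set (Site d)) z x b.1‖ₑ ^ s *
          (‖green lam V (R : Set (Site d)) z b.2 c.1‖ₑ ^ s *
            ‖green lam V (B : Set (Site d)) z c.2 y‖ₑ ^ s) ∂potLaw d ν := by
        have m := fun (b c : Site d × Site d) => (mA b.1).mul ((mR b.2 c.1).mul (mB c.2))
        simp only [Pi.mul_def] at m
        rw [lintegral_finsetSum _ fun b _ => Finset.measurable_fun_sum _ fun c _ => m b c]
        refine Finset.sum_congr rfl fun b _ => ?_
        rw [lintegral_finsetSum _ fun c _ => m b c]
    _ ≤ ∑ b ∈ boundaryBonds Λ, ∑ c ∈ boundaryBonds (fatten Λ),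
        moment ν lam s (A : Set (Site d)) z x b.1 *
          (K * moment ν lam s (B : Set (Site d)) z c.2 y) := by
        refine Finset.sum_le_sum fun b hb => Finset.sum_le_sum fun c hc => ?_
        rw [mem_boundaryBonds] at hb hc
        -- Here fattening matters: `b.2` is outside `Λ` but in `Λ⁺`, while `c.1` is in `Λ⁺` and not
        -- in `Λ`, since its neighbour `c.2` is outside `Λ⁺`. Both sites avoid the two outer
        -- regions.
        refine hK.lintegral_mul_mul_le hz hAB ⟨?_, ?_⟩ ⟨?_, ?_⟩ x b.1 c.2 y
        · exact fun h => hb.2.2 (Finset.mem_inter.1 h).2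
        · exact fun h => (Finset.mem_sdiff.1 h).2 (mem_fatten_of_mem_nbrs hb.1 hb.2.1)
        · exact fun h => hc.2.2 (mem_fatten_of_mem_nbrs (Finset.mem_inter.1 h).2 hc.2.1)
        · exact fun h => (Finset.mem_sdiff.1 h).2 hc.1
    _ = _ := by
        rw [Finset.sum_mul]
        refine Finset.sum_congr rfl fun b _ => ?_
        rw [Finset.mul_sum, Finset.mul_sum]

/-! ### Convergence of fractional moments -/

theorem rpow_le_min_add {g : ℝ≥0∞} {s r : ℝ} (hs : 0 < s) (hsr : s < r) {k : ℕ} (hk : k ≠ 0) :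
    g ^ s ≤ min (g ^ s) ((k : ℝ≥0∞) ^ s) + ((k : ℝ≥0∞)⁻¹) ^ (r - s) * g ^ r := by
  rcases le_total g k with h | h
  · rw [min_eq_left (ENNReal.rpow_le_rpow h hs.le)]
    exact le_add_right le_rfl
  · refine le_add_left ?_
    have h1 : (k : ℝ≥0∞)⁻¹ ^ (r - s) * g ^ r = ((k : ℝ≥0∞)⁻¹ * g) ^ (r - s) * g ^ s := by
      rw [ENNReal.mul_rpow_of_nonneg _ _ (by linarith), mul_assoc,
        ← ENNReal.rpow_add_of_nonneg _ _ (by linarith) hs.le, sub_add_cancel]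
    rw [h1]
    refine le_mul_of_one_le_left' (ENNReal.one_le_rpow ?_ (by linarith))
    calc (1 : ℝ≥0∞) = (k : ℝ≥0∞)⁻¹ * k :=
          (ENNReal.inv_mul_cancel (by exact_mod_cast hk) (by simp)).symm
      _ ≤ _ := by gcongr

/-- Bounded moments of the higher order `r` give uniform integrability of the `s`-th powers. Fatou
gives the lower bound; truncation at `k^s` with dominated convergence gives the upper one, up to
`k^(s-r) B`. -/
theorem tendsto_lintegral_rpow_of_bounded {α ι : Type*} [MeasurableSpace α] {μ : Measure α}
    [IsProbabilityMeasure μ] {l : Filter ι} [l.IsCountablyGenerated] [l.NeBot]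
    {g : ι → α → ℝ≥0∞} {f : α → ℝ≥0∞} (hg : ∀ i, Measurable (g i))
    (hlim : ∀ᵐ a ∂μ, Tendsto (fun i => g i a) l (𝓝 (f a))) {s r : ℝ} (hs : 0 < s) (hsr : s < r)
    {B : ℝ≥0∞} (hB : B ≠ ∞) (hbd : ∀ᶠ i in l, ∫⁻ a, g i a ^ r ∂μ ≤ B) :
    Tendsto (fun i => ∫⁻ a, g i a ^ s ∂μ) l (𝓝 (∫⁻ a, f a ^ s ∂μ)) := by
  have hlims : ∀ᵐ a ∂μ, Tendsto (fun i => g i a ^ s) l (𝓝 (f a ^ s)) := by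
    filter_upwards [hlim] with a ha
    exact (ENNReal.continuous_rpow_const.tendsto _).comp ha
  refine tendsto_of_le_liminf_of_limsup_le ?_ ?_
  · calc ∫⁻ a, f a ^ s ∂μ = ∫⁻ a, liminf (fun i => g i a ^ s) l ∂μ :=
          lintegral_congr_ae (hlims.mono fun a ha => ha.liminf_eq.symm)
      _ ≤ _ := lintegral_liminf_le fun i => (hg i).pow_const s
  · have hk : ∀ k : ℕ, k ≠ 0 → limsup (fun i => ∫⁻ a, g i a ^ s ∂μ) l ≤
        ∫⁻ a, f a ^ s ∂μ + ((k : ℝ≥0∞)⁻¹) ^ (r - s) * B := by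
      intro k hk
      have h1 : Tendsto (fun i => ∫⁻ a, min (g i a ^ s) ((k : ℝ≥0∞) ^ s) ∂μ) l
          (𝓝 (∫⁻ a, min (f a ^ s) ((k : ℝ≥0∞) ^ s) ∂μ)) := by
        refine tendsto_lintegral_filter_of_dominated_convergence (fun _ => (k : ℝ≥0∞) ^ s)
          (Eventually.of_forall fun i => ((hg i).pow_const s).min measurable_const)
          (Eventually.of_forall fun i => Eventually.of_forall fun a => min_le_right _ _) ?_ ?_
        · simpa using ENNReal.rpow_ne_top_of_nonneg hs.le (ENNReal.natCast_ne_top k)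
        · filter_upwards [hlims] with a ha
          exact ha.min tendsto_const_nhds
      have h2 : ∀ᶠ i in l, ∫⁻ a, g i a ^ s ∂μ ≤
          ∫⁻ a, min (g i a ^ s) ((k : ℝ≥0∞) ^ s) ∂μ + ((k : ℝ≥0∞)⁻¹) ^ (r - s) * B := by
        filter_upwards [hbd] with i hi
        calc ∫⁻ a, g i a ^ s ∂μ ≤ ∫⁻ a, (min (g i a ^ s) ((k : ℝ≥0∞) ^ s) +
              ((k : ℝ≥0∞)⁻¹) ^ (r - s) * g i a ^ r) ∂μ :=
              lintegral_mono fun a => rpow_le_min_add hs hsr hk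
          _ = ∫⁻ a, min (g i a ^ s) ((k : ℝ≥0∞) ^ s) ∂μ +
              ((k : ℝ≥0∞)⁻¹) ^ (r - s) * ∫⁻ a, g i a ^ r ∂μ := by
              rw [lintegral_add_left (((hg i).pow_const s).min measurable_const),
                lintegral_const_mul _ ((hg i).pow_const r)]
          _ ≤ _ := by gcongr
      calc _ ≤ limsup (fun i => ∫⁻ a, min (g i a ^ s) ((k : ℝ≥0∞) ^ s) ∂μ +
            ((k : ℝ≥0∞)⁻¹) ^ (r - s) * B) l := limsup_le_limsup h2
        _ = ∫⁻ a, min (f a ^ s) ((k : ℝ≥0∞) ^ s) ∂μ + ((k : ℝ≥0∞)⁻¹) ^ (r - s) * B :=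
            (h1.add tendsto_const_nhds).limsup_eq
        _ ≤ _ := by
            gcongr
            exact min_le_left _ _
    have h3 : Tendsto (fun k : ℕ => ∫⁻ a, f a ^ s ∂μ + ((k : ℝ≥0∞)⁻¹) ^ (r - s) * B) atTop
        (𝓝 (∫⁻ a, f a ^ s ∂μ + 0 * B)) := by
      refine tendsto_const_nhds.add (ENNReal.Tendsto.mul_const ?_ (.inr hB))
      have h4 := (ENNReal.continuous_rpow_const (y := r - s)).tendsto 0 |>.comp
        ENNReal.tendsto_inv_nat_nhds_zero
      rwa [ENNReal.zero_rpow_of_pos (by linarith)] at h4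
    rw [zero_mul, add_zero] at h3
    exact ge_of_tendsto h3 ((eventually_ne_atTop 0).mono hk)

theorem IsRegularLaw.nullSingletonClass {ν : Measure ℝ} (hν : IsRegularLaw ν) :
    NullSingletonClass ν := by
  obtain ⟨ρ, -, -, -, -, rfl⟩ := hν
  exact ⟨fun t => withDensity_absolutelyContinuous _ _ (measure_singleton t)⟩

/-- Compact support bounds every site by one constant, and the lattice is countable. Thus the
default value of `ham` occurs only on a null set. -/
theorem ae_boundedOn {d : ℕ} {ν : Measure ℝ} [IsProbabilityMeasure ν] (hν : IsRegularLaw ν)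
    (Ω : Set (Site d)) : ∀ᵐ V ∂potLaw d ν, BoundedOn V Ω := by
  obtain ⟨ρ, hm, -, -, hcs, rfl⟩ := hν
  obtain ⟨M, hM⟩ := hcs.isCompact.isBounded.exists_norm_le
  have h1 : ∀ᵐ t ∂(volume.withDensity fun v => ENNReal.ofReal (ρ v)), |t| ≤ M := by
    rw [ae_withDensity_iff (by fun_prop)]
    refine Eventually.of_forall fun t ht => hM t (subset_tsupport _ ?_)
    intro h
    exact ht (by simp [h])
  have h2 : ∀ a : Site d, ∀ᵐ V ∂potLaw d (volume.withDensity fun v => ENNReal.ofReal (ρ v)),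
      |V a| ≤ M := fun a => by
    have hp := measurePreserving_eval_infinitePi
      (fun _ : Site d => volume.withDensity fun v => ENNReal.ofReal (ρ v)) a
    exact hp.quasiMeasurePreserving.ae h1
  filter_upwards [ae_all_iff.2 h2] with V hV
  exact ⟨M, fun a _ => hV a⟩

/-- Add the sites one at a time: by `subsingleton_not_resolvent_update` each new site has at most
one bad value, and `ν` has no atoms. This also covers real `z`. -/
theorem ae_resolvent {d : ℕ} {ν : Measure ℝ} [IsProbabilityMeasure ν] (hν : IsRegularLaw ν)
    {lam : ℝ} (hlam : lam ≠ 0) (W : Finset (Site d)) (z : ℂ) :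
    ∀ᵐ V ∂potLaw d ν, Resolvent lam V (W : Set (Site d)) z := by
  classical
  have := hν.nullSingletonClass
  induction W using Finset.induction_on with
  | empty =>
    refine Eventually.of_forall fun V => ?_
    have : IsEmpty ((∅ : Finset (Site d)) : Set (Site d)) := by simp
    have : Subsingleton (L2 (((∅ : Finset (Site d)) : Set (Site d)))) :=
      ⟨fun ψ φ => by ext x; exact isEmptyElim x⟩
    exact isUnit_of_subsingleton _
  | insert x W hx ih =>
    set S := {V : Site d → ℝ | Resolvent lam V (insert x W : Finset (Site d)) z}
    have hS : MeasurableSet Sᶜ := (measurableSet_resolvent lam (insert x W) z).compl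
    rw [ae_iff]
    change potLaw d ν Sᶜ = 0
    rw [← lintegral_indicator_one hS,
      lintegral_potLaw_update x (F := Sᶜ.indicator 1) (measurable_one.indicator hS)]
    refine (lintegral_congr_ae (ih.mono fun V hV => ?_)).trans lintegral_zero
    have hsub := subsingleton_not_resolvent_update hlam hV hx
    have h0 : ν ((fun t => Function.update V x t) ⁻¹' Sᶜ) = 0 := hsub.measure_zero ν
    have hmeas : MeasurableSet ((fun t => Function.update V x t) ⁻¹' Sᶜ) :=
      ((measurable_update_pair x).comp measurable_prodMk_left) hS
    rw [← h0, ← lintegral_indicator_one hmeas]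
    rfl

theorem tendsto_moment_energy {d : ℕ} {ν : Measure ℝ} [IsProbabilityMeasure ν]
    (hν : IsRegularLaw ν) {lam : ℝ} (hlam : lam ≠ 0) {s r : ℝ} (hs : 0 < s) (hsr : s < r)
    {K : ℝ≥0∞} (hKtop : K ≠ ∞) (hK : AprioriBound d ν lam r K) (W : Finset (Site d)) (E : ℂ)
    {l : Filter ℂ} [l.IsCountablyGenerated] [l.NeBot] (hl : l ≤ 𝓝 E)
    (him : ∀ᶠ z in l, z.im ≠ 0) (x y : Site d) :
    Tendsto (fun z => moment ν lam s (W : Set (Site d)) z x y) l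
      (𝓝 (moment ν lam s (W : Set (Site d)) E x y)) := by
  refine tendsto_lintegral_rpow_of_bounded (fun z => (measurable_green lam W z x y).enorm) ?_ hs hsr
    hKtop (him.mono fun z hz => hK.moment_le W hz x y)
  filter_upwards [ae_resolvent hν hlam W E] with V hV
  have h := (isOpen_resolvent_and_continuousOn_green lam W x y).2 (V, E) hV
  have h2 : ContinuousAt (fun z => green lam V (W : Set (Site d)) z x y) E :=
    ContinuousAt.comp (f := fun z : ℂ => (V, z)) h
      (by fun_prop : Continuous fun z : ℂ => (V, z)).continuousAt
  exact (continuous_enorm.tendsto _).comp (h2.mono_left hl)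

theorem ae_tendsto_green_cut {d : ℕ} {ν : Measure ℝ} [IsProbabilityMeasure ν]
    (hν : IsRegularLaw ν) (lam : ℝ) {Ω : Set (Site d)} {z : ℂ} (hz : z.im ≠ 0) {x y : Site d}
    (hx : x ∈ Ω) (hy : y ∈ Ω) :
    ∀ᵐ V ∂potLaw d ν, Tendsto (fun L => ‖green lam V (cut Ω L : Set (Site d)) z x y‖ₑ) atTop
      (𝓝 ‖green lam V Ω z x y‖ₑ) := by
  filter_upwards [ae_boundedOn hν Ω] with V hV
  exact (continuous_enorm.tendsto _).comp (tendsto_green_cut hV hz hx hy)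

theorem aemeasurable_enorm_green_rpow {d : ℕ} {ν : Measure ℝ} [IsProbabilityMeasure ν]
    (hν : IsRegularLaw ν) (lam s : ℝ) {Ω : Set (Site d)} {z : ℂ} (hz : z.im ≠ 0) {x y : Site d}
    (hx : x ∈ Ω) (hy : y ∈ Ω) :
    AEMeasurable (fun V : Site d → ℝ => ‖green lam V Ω z x y‖ₑ ^ s) (potLaw d ν) :=
  (aemeasurable_of_tendsto_metrizable_ae atTop
    (fun L => (measurable_green lam (cut Ω L) z x y).enorm.aemeasurable)
    (ae_tendsto_green_cut hν lam hz hx hy)).pow_const s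

theorem tendsto_moment_cut {d : ℕ} {ν : Measure ℝ} [IsProbabilityMeasure ν]
    (hν : IsRegularLaw ν) {lam : ℝ} {s r : ℝ} (hs : 0 < s) (hsr : s < r)
    {K : ℝ≥0∞} (hKtop : K ≠ ∞) (hK : AprioriBound d ν lam r K) {Ω : Set (Site d)} {z : ℂ}
    (hz : z.im ≠ 0) {x y : Site d} (hx : x ∈ Ω) (hy : y ∈ Ω) :
    Tendsto (fun L => moment ν lam s (cut Ω L : Set (Site d)) z x y) atTop
      (𝓝 (moment ν lam s Ω z x y)) :=
  tendsto_lintegral_rpow_of_bounded (fun L => (measurable_green lam (cut Ω L) z x y).enorm)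
    (ae_tendsto_green_cut hν lam hz hx hy) hs hsr hKtop
    (Eventually.of_forall fun L => hK.moment_le (cut Ω L) hz x y)

/-! ### Exponential decay in finite volumes -/

theorem siteDist_nonneg {d : ℕ} (x y : Site d) : 0 ≤ siteDist x y :=
  Finset.sum_nonneg fun _ _ => abs_nonneg _

theorem siteDist_triangle {d : ℕ} (x y z : Site d) :
    siteDist x z ≤ siteDist x y + siteDist y z := by
  rw [siteDist, siteDist, siteDist, ← Finset.sum_add_distrib]
  exact Finset.sum_le_sum fun i _ => abs_sub_le _ _ _

theorem siteDist_sub_right {d : ℕ} (x y a : Site d) :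
    siteDist (x - a) (y - a) = siteDist x y := by
  simp [siteDist]

/-- Iteration of the decoupling inequality. -/
theorem AprioriBound.moment_le_pow {d : ℕ} {ν : Measure ℝ} [IsProbabilityMeasure ν]
    {lam s : ℝ} (hs0 : 0 < s) (hs1 : s ≤ 1) {K : ℝ≥0∞} (hK : AprioriBound d ν lam s K)
    {z : ℂ} (hz : z.im ≠ 0) {Λ : Finset (Site d)} (h0 : 0 ∈ Λ) {q : ℝ≥0∞}
    (hq : ∀ W ⊆ Λ, ((boundaryBonds (fatten Λ)).card : ℝ≥0∞) * K *
      ∑ b ∈ boundaryBonds Λ, moment ν lam s (W : Set (Site d)) z 0 b.1 ≤ q)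
    {ρ : ℝ} (hρ : ∀ a ∈ fatten (fatten Λ), siteDist 0 a < ρ) (hρ0 : 0 < ρ) (n : ℕ) :
    ∀ (R : Finset (Site d)) (x y : Site d), n * ρ ≤ siteDist x y →
      moment ν lam s (R : Set (Site d)) z x y ≤ q ^ n * K := by
  classical
  induction n with
  | zero =>
    intro R x y _
    simpa using hK.moment_le R hz x y
  | succ n ih =>
    intro R x y hxy
    -- Moving `x` to the origin changes the region, and the next step removes `Λ⁺` from it; hence
    -- the induction is over all finite `R` at once.
    rw [← moment_translate lam s R hz x x y, sub_self]
    set T := translate x R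
    have hd : (n + 1) * ρ ≤ siteDist 0 (y - x) := by
      rw [← sub_self x, siteDist_sub_right]
      exact_mod_cast hxy
    have hy : y - x ∉ fatten Λ := by
      intro h
      have := hρ _ (subset_fatten _ h)
      nlinarith [mul_nonneg (Nat.cast_nonneg (α := ℝ) n) hρ0.le]
    refine (hK.moment_le_sum hs0 hs1 hz T Λ h0 hy).trans ?_
    have h1 : ∑ c ∈ boundaryBonds (fatten Λ),
        moment ν lam s ((T \ fatten Λ : Finset (Site d)) : Set (Site d)) z c.2 (y - x) ≤
        ((boundaryBonds (fatten Λ)).card : ℝ≥0∞) * (q ^ n * K) := by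
      rw [← nsmul_eq_mul, ← Finset.sum_const]
      -- The site `c.2` lies in `Λ⁺⁺`, so it is within `ρ` of the origin: each iteration uses up at
      -- most `ρ` of the distance to `y`.
      refine Finset.sum_le_sum fun c hc => ih _ _ _ ?_
      have hc' := mem_boundaryBonds.1 hc
      have h2 := hρ c.2 (mem_fatten_of_mem_nbrs hc'.1 hc'.2.1)
      have h3 := siteDist_triangle 0 c.2 (y - x)
      linarith
    calc _ ≤ (∑ b ∈ boundaryBonds Λ,
          moment ν lam s ((T ∩ Λ : Finset (Site d)) : Set (Site d)) z 0 b.1) *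
          (K * (((boundaryBonds (fatten Λ)).card : ℝ≥0∞) * (q ^ n * K))) := by gcongr
      _ = (((boundaryBonds (fatten Λ)).card : ℝ≥0∞) * K * ∑ b ∈ boundaryBonds Λ,
          moment ν lam s ((T ∩ Λ : Finset (Site d)) : Set (Site d)) z 0 b.1) * (q ^ n * K) := by
          ring
      _ ≤ q * (q ^ n * K) := by
          gcongr
          exact hq _ Finset.inter_subset_right
      _ = _ := by ring

/-- Rounding down costs less than one step, hence the factor `q⁻¹`. -/
theorem pow_floor_le_exp {q ρ t : ℝ} (hq0 : 0 < q) (hq1 : q < 1) (hρ : 0 < ρ) :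
    q ^ ⌊t / ρ⌋₊ ≤ q⁻¹ * Real.exp (-(-Real.log q / ρ) * t) := by
  have h1 : q ^ (t / ρ - 1) = q⁻¹ * Real.exp (-(-Real.log q / ρ) * t) := by
    rw [Real.rpow_sub hq0, Real.rpow_one, Real.rpow_def_of_pos hq0, div_eq_inv_mul]
    congr 2
    field_simp
  rw [← h1, ← Real.rpow_natCast]
  refine Real.rpow_le_rpow_of_exponent_ge hq0 hq1.le ?_
  linarith [Nat.lt_floor_add_one (t / ρ)]

/-- Exponential decay of the moments of all finite-volume Green functions at the energy `z`. -/
def ExpDecay {d : ℕ} (ν : Measure ℝ) (lam s : ℝ) (z : ℂ) (A μ : ℝ) : Prop :=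
  ∀ (R : Finset (Site d)) (x y : Site d), moment ν lam s (R : Set (Site d)) z x y ≤
    ENNReal.ofReal (A * Real.exp (-μ * siteDist x y))

theorem AprioriBound.expDecay {d : ℕ} {ν : Measure ℝ} [IsProbabilityMeasure ν]
    {lam s : ℝ} (hs0 : 0 < s) (hs1 : s ≤ 1) {k : ℝ} (hk : 0 ≤ k)
    (hK : AprioriBound d ν lam s (ENNReal.ofReal k))
    {z : ℂ} (hz : z.im ≠ 0) {Λ : Finset (Site d)} (h0 : 0 ∈ Λ) {q : ℝ} (hq0 : 0 < q) (hq1 : q < 1)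
    (hq : ∀ W ⊆ Λ, ((boundaryBonds (fatten Λ)).card : ℝ≥0∞) * ENNReal.ofReal k *
      ∑ b ∈ boundaryBonds Λ, moment ν lam s (W : Set (Site d)) z 0 b.1 ≤ ENNReal.ofReal q)
    {ρ : ℝ} (hρ : ∀ a ∈ fatten (fatten Λ), siteDist 0 a < ρ) (hρ0 : 0 < ρ) :
    ExpDecay (d := d) ν lam s z (k / q) (-Real.log q / ρ) := by
  intro R x y
  have h1 : (⌊siteDist x y / ρ⌋₊ : ℝ) * ρ ≤ siteDist x y := by
    have := Nat.floor_le (div_nonneg (siteDist_nonneg x y) hρ0.le)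
    rwa [le_div_iff₀ hρ0] at this
  refine (hK.moment_le_pow hs0 hs1 hz h0 hq hρ hρ0 _ R x y h1).trans ?_
  rw [← ENNReal.ofReal_pow hq0.le, ← ENNReal.ofReal_mul (by positivity)]
  refine ENNReal.ofReal_le_ofReal ?_
  have h2 := mul_le_mul_of_nonneg_right
    (pow_floor_le_exp (t := siteDist x y) hq0 hq1 hρ0) hk
  refine h2.trans (le_of_eq ?_)
  rw [div_eq_mul_inv]
  ring

/-! ### Comparison of different volumes -/

theorem le_siteDist_of_not_mem_box {d L : ℕ} {a : Site d} (ha : a ∉ box d L) :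
    (L : ℝ) ≤ siteDist 0 a := by
  simp only [box, Fintype.mem_piFinset, Finset.mem_Icc, not_forall] at ha
  obtain ⟨i, hi⟩ := ha
  have h1 : (L : ℤ) ≤ |a i| := by
    rcases le_total 0 (a i) with h | h
    · rw [abs_of_nonneg h]; omega
    · rw [abs_of_nonpos h]; omega
  have h2 : |((0 : Site d) i : ℝ) - (a i : ℝ)| ≤ siteDist 0 a :=
    Finset.single_le_sum (f := fun i => |((0 : Site d) i : ℝ) - (a i : ℝ)|)
      (fun _ _ => abs_nonneg _) (Finset.mem_univ i)
  refine le_trans ?_ h2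
  simp only [Pi.zero_apply, Int.cast_zero, zero_sub, abs_neg]
  exact_mod_cast h1

theorem card_boundaryBonds_cut_le {d : ℕ} (Ω : Set (Site d)) (L : ℕ) :
    ((boundaryBonds (cut Ω L)).card : ℝ) ≤ 2 * d * (2 * L + 1) ^ d := by
  have h1 : (boundaryBonds (cut Ω L)).card =
      ∑ u ∈ cut Ω L, ((nbrs u).filter (· ∉ cut Ω L)).card := by
    simp only [Finset.card_eq_sum_ones]
    exact sum_boundaryBonds _ fun _ _ => 1
  have h2 : (boundaryBonds (cut Ω L)).card ≤ (cut Ω L).card * (2 * d) := by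
    rw [h1]
    exact (Finset.sum_le_card_nsmul _ _ _ fun u _ =>
      (Finset.card_filter_le _ _).trans (card_nbrs_le u)).trans (by simp)
  have h3 : (cut Ω L).card ≤ (2 * L + 1) ^ d := by
    refine (Finset.card_le_card fun a ha => (mem_cut.1 ha).1).trans (le_of_eq ?_)
    rw [box, Fintype.card_piFinset]
    simp only [Int.card_Icc, Finset.prod_const, Finset.card_univ, Fintype.card_fin]
    congr 1
    omega
  have h4 : (boundaryBonds (cut Ω L)).card ≤ (2 * L + 1) ^ d * (2 * d) :=
    h2.trans (Nat.mul_le_mul_right _ h3)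
  calc ((boundaryBonds (cut Ω L)).card : ℝ) ≤ (((2 * L + 1) ^ d * (2 * d) : ℕ) : ℝ) := by
        exact_mod_cast h4
    _ = _ := by push_cast; ring

/-- Bound on the half-order moments of the difference of the Green functions of two volumes. -/
noncomputable def cutError (d : ℕ) (A μ D : ℝ) (L : ℕ) : ℝ :=
  2 * d * (2 * L + 1) ^ d * (A * Real.exp (-(μ / 2) * (L - D)))

theorem tendsto_cutError (d : ℕ) (A : ℝ) {μ : ℝ} (hμ : 0 < μ) (D : ℝ) :
    Tendsto (cutError d A μ D) atTop (𝓝 0) := by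
  -- The exponent `μL/2` is rewritten as `(μ/4)(2L+1)` up to a constant, so that the volume factor
  -- becomes a power of the same variable.
  have h1 : Tendsto (fun L : ℕ => μ / 4 * (2 * (L : ℝ) + 1)) atTop atTop :=
    ((tendsto_natCast_atTop_atTop.const_mul_atTop (by norm_num : (0 : ℝ) < 2)).atTop_add
      tendsto_const_nhds).const_mul_atTop (by positivity)
  have h2 := ((Real.tendsto_pow_mul_exp_neg_atTop_nhds_zero d).comp h1).const_mul
    (2 * d * A * Real.exp (μ / 2 * D + μ / 4) * (4 / μ) ^ d)
  rw [mul_zero] at h2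
  refine h2.congr fun L => ?_
  have h3 : (4 / μ) ^ d * (μ / 4 * (2 * (L : ℝ) + 1)) ^ d = (2 * L + 1) ^ d := by
    rw [← mul_pow]
    congr 1
    field_simp
  simp only [Function.comp_apply, cutError]
  rw [show -(μ / 2) * ((L : ℝ) - D) = (μ / 2 * D + μ / 4) + -(μ / 4 * (2 * L + 1)) by ring,
    Real.exp_add (μ / 2 * D + μ / 4)]
  linear_combination 2 * d * A * Real.exp (μ / 2 * D + μ / 4) *
    Real.exp (-(μ / 4 * (2 * L + 1))) * h3

/-- The two Green functions in the boundary sum are correlated. Order `s/2` lets Cauchy–Schwarz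
reduce their product to separate moments of order `s`; the decay comes from the factor joining a
site outside the box to `y`. -/
theorem lintegral_green_sub_rpow_half_le {d : ℕ} {ν : Measure ℝ} [IsProbabilityMeasure ν]
    {lam s : ℝ} (hs0 : 0 < s) (hs1 : s ≤ 1) {z : ℂ} (hz : z.im ≠ 0) {A μ : ℝ} (hA : 0 ≤ A)
    (hμ : 0 < μ) (hdec : ExpDecay (d := d) ν lam s z A μ) {Ω : Set (Site d)} {L L' : ℕ}
    (hL : L ≤ L') {x y : Site d} (hx : x ∈ cut Ω L) :
    ∫⁻ V, ‖green lam V (cut Ω L' : Set (Site d)) z x y -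
        green lam V (cut Ω L : Set (Site d)) z x y‖ₑ ^ (s / 2) ∂potLaw d ν ≤
      ENNReal.ofReal (cutError d A μ (siteDist 0 y) L) := by
  set W := cut Ω L
  set W' := cut Ω L'
  have hWW' : W ⊆ W' := fun a ha => by
    rw [mem_cut] at ha ⊢
    refine ⟨?_, ha.2⟩
    exact Fintype.piFinset_subset _ _ (fun _ => Finset.Icc_subset_Icc (by simp [hL]) (by simp [hL]))
      ha.1
  by_cases hyW' : y ∈ W'
  swap
  · have hyW : y ∉ W := fun h => hyW' (hWW' h)
    simp [green_eq_zero_right (Ω := (W : Set (Site d))) (y := y) (by simpa using hyW),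
      green_eq_zero_right (Ω := (W' : Set (Site d))) (y := y) (by simpa using hyW'), hs0]
  have hpt : ∀ V : Site d → ℝ, ‖green lam V (W' : Set (Site d)) z x y -
      green lam V (W : Set (Site d)) z x y‖ₑ ^ (s / 2) ≤
      ∑ b ∈ boundaryBonds W, (‖green lam V (W : Set (Site d)) z x b.1‖ₑ ^ s) ^ (1 / 2 : ℝ) *
        (‖green lam V (W' : Set (Site d)) z b.2 y‖ₑ ^ s) ^ (1 / 2 : ℝ) := by
    intro V
    rw [green_eq_add_boundary (boundedOn_finset V W') (resolvent_of_im_ne_zero lam V _ hz)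
      (resolvent_of_im_ne_zero lam V _ hz) (by exact_mod_cast hWW') hx (by simpa using hyW'),
      add_sub_cancel_left]
    refine (ENNReal.rpow_le_rpow (enorm_sum_le _ _) (by positivity)).trans
      ((rpow_sum_le_sum_rpow _ _ (by positivity) (by linarith)).trans (le_of_eq ?_))
    refine Finset.sum_congr rfl fun b _ => ?_
    rw [enorm_mul, ENNReal.mul_rpow_of_nonneg _ _ (by positivity), ← ENNReal.rpow_mul,
      ← ENNReal.rpow_mul, mul_one_div]
  have m1 := fun a => measurable_enorm_green_rpow lam s W z x a
  have m2 := fun a => measurable_enorm_green_rpow lam s W' z a y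
  calc _ ≤ ∫⁻ V, ∑ b ∈ boundaryBonds W, (‖green lam V (W : Set (Site d)) z x b.1‖ₑ ^ s) ^
        (1 / 2 : ℝ) * (‖green lam V (W' : Set (Site d)) z b.2 y‖ₑ ^ s) ^ (1 / 2 : ℝ) ∂potLaw d ν :=
        lintegral_mono hpt
    _ = ∑ b ∈ boundaryBonds W, ∫⁻ V, (‖green lam V (W : Set (Site d)) z x b.1‖ₑ ^ s) ^
        (1 / 2 : ℝ) * (‖green lam V (W' : Set (Site d)) z b.2 y‖ₑ ^ s) ^ (1 / 2 : ℝ) ∂potLaw d ν := by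
        have m := fun b : Site d × Site d =>
          ((m1 b.1).pow_const (1 / 2 : ℝ)).mul ((m2 b.2).pow_const (1 / 2 : ℝ))
        simp only [Pi.mul_def] at m
        exact lintegral_finsetSum _ fun b _ => m b
    _ ≤ ∑ b ∈ boundaryBonds W, ENNReal.ofReal
        (A * Real.exp (-(μ / 2) * (L - siteDist 0 y))) := by
        refine Finset.sum_le_sum fun b hb => ?_
        refine (ENNReal.lintegral_mul_norm_pow_le (m1 b.1).aemeasurable (m2 b.2).aemeasurable
          (by norm_num) (by norm_num) (by norm_num)).trans ?_
        change moment ν lam s (W : Set (Site d)) z x b.1 ^ (1 / 2 : ℝ) *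
          moment ν lam s (W' : Set (Site d)) z b.2 y ^ (1 / 2 : ℝ) ≤ _
        by_cases hb2 : b.2 ∈ Ω
        swap
        · rw [moment_eq_zero_left (x := b.2) hs0]
          · simp
          · exact fun h => hb2 (mem_cut.1 (by simpa using h)).2
        have hbox : b.2 ∉ box d L := fun h => (mem_boundaryBonds.1 hb).2.2 (mem_cut.2 ⟨h, hb2⟩)
        have hdist : (L : ℝ) - siteDist 0 y ≤ siteDist b.2 y := by
          have h1 := le_siteDist_of_not_mem_box hbox
          have h2 := siteDist_triangle 0 y b.2
          have h3 : siteDist y b.2 = siteDist b.2 y := by simp only [siteDist, abs_sub_comm]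
          linarith
        have e1 : moment ν lam s (W : Set (Site d)) z x b.1 ≤ ENNReal.ofReal A := by
          refine (hdec W x b.1).trans (ENNReal.ofReal_le_ofReal ?_)
          refine mul_le_of_le_one_right hA (Real.exp_le_one_iff.2 ?_)
          have := mul_nonneg hμ.le (siteDist_nonneg x b.1)
          linarith
        have e2 : moment ν lam s (W' : Set (Site d)) z b.2 y ≤
            ENNReal.ofReal (A * Real.exp (-μ * (L - siteDist 0 y))) := by
          refine (hdec W' b.2 y).trans (ENNReal.ofReal_le_ofReal ?_)
          refine mul_le_mul_of_nonneg_left (Real.exp_le_exp.2 ?_) hA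
          nlinarith
        refine (mul_le_mul' (ENNReal.rpow_le_rpow e1 (by norm_num))
          (ENNReal.rpow_le_rpow e2 (by norm_num))).trans (le_of_eq ?_)
        rw [ENNReal.ofReal_rpow_of_nonneg hA (by norm_num),
          ENNReal.ofReal_rpow_of_nonneg (by positivity) (by norm_num),
          ← ENNReal.ofReal_mul (by positivity), Real.mul_rpow hA (by positivity), ← mul_assoc,
          ← Real.mul_rpow hA hA, ← pow_two, ← Real.sqrt_eq_rpow, Real.sqrt_sq hA, ← Real.exp_mul]
        congr 3
        ring
    _ ≤ _ := by
        rw [Finset.sum_const, nsmul_eq_mul, cutError, ← ENNReal.ofReal_natCast,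
          ← ENNReal.ofReal_mul (by positivity)]
        refine ENNReal.ofReal_le_ofReal ?_
        gcongr
        exact card_boundaryBonds_cut_le Ω L

/-- Bound on the fractional moments of the difference of the Green functions of two volumes. -/
noncomputable def momentError (d : ℕ) (s r A μ D : ℝ) (K : ℝ≥0∞) (L : ℕ) : ℝ≥0∞ :=
  ENNReal.ofReal (cutError d A μ D L) ^ ((r - s) / (r - s / 2)) *
    (2 * K) ^ (s / 2 / (r - s / 2))

theorem tendsto_momentError (d : ℕ) {s r : ℝ} (hs : 0 < s) (hsr : s < r) (A : ℝ) {μ : ℝ}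
    (hμ : 0 < μ) (D : ℝ) {K : ℝ≥0∞} (hK : K ≠ ∞) :
    Tendsto (momentError d s r A μ D K) atTop (𝓝 0) := by
  have hpos : 0 < r - s / 2 := by linarith
  have h1 := (ENNReal.continuous_rpow_const (y := (r - s) / (r - s / 2))).tendsto 0 |>.comp
    ((ENNReal.tendsto_ofReal (tendsto_cutError d A hμ D)).trans (by simp))
  rw [ENNReal.zero_rpow_of_pos (div_pos (by linarith) hpos)] at h1
  have h2 := ENNReal.Tendsto.mul_const (b := (2 * K) ^ (s / 2 / (r - s / 2))) h1
    (.inr (ENNReal.rpow_ne_top_of_nonneg (by positivity) (ENNReal.mul_ne_top (by simp) hK)))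
  rw [zero_mul] at h2
  exact h2

/-- Hölder interpolation between order `s/2`, where the difference is small, and order `r`, where it
is bounded by `2K`. With `θ = (r-s)/(r-s/2)` one has `s = θ s/2 + (1-θ) r`. -/
theorem lintegral_green_sub_rpow_le {d : ℕ} {ν : Measure ℝ} [IsProbabilityMeasure ν]
    {lam s r : ℝ} (hs0 : 0 < s) (hsr : s < r) (hr1 : r ≤ 1) {K : ℝ≥0∞}
    (hK : AprioriBound d ν lam r K) {z : ℂ} (hz : z.im ≠ 0) {A μ : ℝ} (hA : 0 ≤ A)
    (hμ : 0 < μ) (hdec : ExpDecay (d := d) ν lam s z A μ) {Ω : Set (Site d)} {L L' : ℕ}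
    (hL : L ≤ L') {x y : Site d} (hx : x ∈ cut Ω L) :
    ∫⁻ V, ‖green lam V (cut Ω L' : Set (Site d)) z x y -
        green lam V (cut Ω L : Set (Site d)) z x y‖ₑ ^ s ∂potLaw d ν ≤
      momentError d s r A μ (siteDist 0 y) K L := by
  have m1 := measurable_green lam (cut Ω L) z x y
  have m2 := measurable_green lam (cut Ω L') z x y
  have hpos : 0 < r - s / 2 := by linarith
  have hne : r * 2 - s ≠ 0 := by linarith
  set D : (Site d → ℝ) → ℝ≥0∞ := fun V => ‖green lam V (cut Ω L' : Set (Site d)) z x y -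
        green lam V (cut Ω L : Set (Site d)) z x y‖ₑ with hD
  have mD : Measurable D := (m2.sub m1).enorm
  have hr : ∫⁻ V, D V ^ r ∂potLaw d ν ≤ 2 * K := by
    calc _ ≤ ∫⁻ V, (‖green lam V (cut Ω L' : Set (Site d)) z x y‖ₑ ^ r +
          ‖green lam V (cut Ω L : Set (Site d)) z x y‖ₑ ^ r) ∂potLaw d ν :=
          lintegral_mono fun V => (ENNReal.rpow_le_rpow enorm_sub_le (by linarith)).trans
            (ENNReal.rpow_add_le_add_rpow _ _ (by linarith) hr1)
      _ = _ := lintegral_add_left (m2.enorm.pow_const r) _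
      _ ≤ K + K := add_le_add (hK.moment_le _ hz x y) (hK.moment_le _ hz x y)
      _ = 2 * K := (two_mul K).symm
  calc ∫⁻ V, D V ^ s ∂potLaw d ν
      = ∫⁻ V, (D V ^ (s / 2)) ^ ((r - s) / (r - s / 2)) * (D V ^ r) ^ (s / 2 / (r - s / 2))
          ∂potLaw d ν := by
        refine lintegral_congr fun V => ?_
        rw [← ENNReal.rpow_mul, ← ENNReal.rpow_mul, ← ENNReal.rpow_add_of_nonneg]
        · congr 1
          have e : s / 2 * ((r - s) / (r - s / 2)) + r * (s / 2 / (r - s / 2)) =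
              s * ((r - s / 2) / (r - s / 2)) := by ring
          rw [e, div_self hpos.ne', mul_one]
        · exact mul_nonneg (by linarith) (div_nonneg (by linarith) hpos.le)
        · exact mul_nonneg (by linarith) (div_nonneg (by linarith) hpos.le)
    _ ≤ _ := ENNReal.lintegral_mul_norm_pow_le (mD.pow_const _).aemeasurable
        (mD.pow_const _).aemeasurable (div_nonneg (by linarith) hpos.le)
        (div_nonneg (by linarith) hpos.le) (by field_simp; ring)
    _ ≤ _ := by
        rw [momentError]
        refine mul_le_mul' (ENNReal.rpow_le_rpow ?_ (div_nonneg (by linarith) hpos.le))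
          (ENNReal.rpow_le_rpow hr (div_nonneg (by linarith) hpos.le))
        exact lintegral_green_sub_rpow_half_le hs0 (by linarith) hz hA hμ hdec hL hx

theorem moment_le_moment_add {d : ℕ} {ν : Measure ℝ} [IsProbabilityMeasure ν] {lam s : ℝ}
    (hs0 : 0 < s) (hs1 : s ≤ 1) {W W' : Finset (Site d)} {z : ℂ} {x y : Site d} :
    moment ν lam s (W' : Set (Site d)) z x y ≤ moment ν lam s (W : Set (Site d)) z x y +
      ∫⁻ V, ‖green lam V (W' : Set (Site d)) z x y - green lam V (W : Set (Site d)) z x y‖ₑ ^ s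
        ∂potLaw d ν := by
  rw [moment, moment, ← lintegral_add_left (measurable_enorm_green_rpow lam s W z x y)]
  refine lintegral_mono fun V => ?_
  refine le_trans (ENNReal.rpow_le_rpow ?_ hs0.le) (ENNReal.rpow_add_le_add_rpow _ _ hs0.le hs1)
  have := enorm_add_le (green lam V (W : Set (Site d)) z x y)
    (green lam V (W' : Set (Site d)) z x y - green lam V (W : Set (Site d)) z x y)
  rwa [add_sub_cancel] at this

/-- The moments in a volume and in its cut-offs differ by an error that is uniform in the energy. -/
theorem moment_cut_approx {d : ℕ} {ν : Measure ℝ} [IsProbabilityMeasure ν] (hν : IsRegularLaw ν)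
    {lam s r : ℝ} (hs0 : 0 < s) (hsr : s < r) (hr1 : r ≤ 1) {K : ℝ≥0∞} (hKtop : K ≠ ∞)
    (hK : AprioriBound d ν lam r K) {z : ℂ} (hz : z.im ≠ 0) {A μ : ℝ} (hA : 0 ≤ A)
    (hμ : 0 < μ) (hdec : ExpDecay (d := d) ν lam s z A μ) {Ω : Set (Site d)} {L : ℕ}
    {x y : Site d} (hx : x ∈ cut Ω L) (hy : y ∈ Ω) :
    moment ν lam s Ω z x y ≤ moment ν lam s (cut Ω L : Set (Site d)) z x y +
        momentError d s r A μ (siteDist 0 y) K L ∧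
      moment ν lam s (cut Ω L : Set (Site d)) z x y ≤ moment ν lam s Ω z x y +
        momentError d s r A μ (siteDist 0 y) K L := by
  have hlim := tendsto_moment_cut hν hs0 hsr hKtop hK hz (mem_cut.1 hx).2 hy
  have herr := fun L' (hL : L ≤ L') =>
    lintegral_green_sub_rpow_le hs0 hsr hr1 hK hz hA hμ hdec hL hx (y := y)
  have hs1 : s ≤ 1 := by linarith
  constructor
  · refine le_of_tendsto hlim ((eventually_ge_atTop L).mono fun L' hL => ?_)
    exact (moment_le_moment_add hs0 hs1).trans (add_le_add_right (herr L' hL) _)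
  · refine ge_of_tendsto (hlim.add tendsto_const_nhds)
      ((eventually_ge_atTop L).mono fun L' hL => ?_)
    refine (moment_le_moment_add hs0 hs1 (W := cut Ω L')).trans (add_le_add_right ?_ _)
    refine le_trans (le_of_eq (lintegral_congr fun V => ?_)) (herr L' hL)
    rw [← enorm_neg, neg_sub]

/-- In each cut-off the moments converge as `z → E`, and the cut-off error `ε L` is uniform in `z`.
So limsup and liminf in `Ω` differ by at most `2 ε L`, which tends to 0. -/
theorem exists_tendsto_moment {d : ℕ} {ν : Measure ℝ} [IsProbabilityMeasure ν]
    (hν : IsRegularLaw ν) {lam s r : ℝ} (hlam : lam ≠ 0) (hs0 : 0 < s) (hsr : s < r) (hr1 : r ≤ 1)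
    {K : ℝ≥0∞} (hKtop : K ≠ ∞) (hK : AprioriBound d ν lam r K) {E : ℂ} {l : Filter ℂ}
    [l.IsCountablyGenerated] [l.NeBot] (hl : l ≤ 𝓝 E) (him : ∀ᶠ z in l, z.im ≠ 0) {A μ : ℝ}
    (hA : 0 ≤ A) (hμ : 0 < μ) (hdec : ∀ᶠ z in l, ExpDecay (d := d) ν lam s z A μ)
    {Ω : Set (Site d)} {x y : Site d} (hx : x ∈ Ω) (hy : y ∈ Ω) :
    ∃ M : ℝ≥0∞, Tendsto (fun z => moment ν lam s Ω z x y) l (𝓝 M) ∧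
      M ≤ ENNReal.ofReal (A * Real.exp (-μ * siteDist x y)) := by
  set m := fun z => moment ν lam s Ω z x y with hm
  set ε := momentError d s r A μ (siteDist 0 y) K with hε
  have hbox : ∀ᶠ L in atTop, x ∈ cut Ω L := by
    filter_upwards [(tendsto_box d).eventually (eventually_ge_atTop {x})] with L hL
    exact mem_cut.2 ⟨hL (by simp), hx⟩
  have hkey : ∀ᶠ L in atTop, limsup m l ≤ liminf m l + (ε L + ε L) := by
    filter_upwards [hbox] with L hL
    have h1 := tendsto_moment_energy hν hlam hs0 hsr hKtop hK (cut Ω L) E hl him x y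
    set mL := fun z => moment ν lam s (cut Ω L : Set (Site d)) z x y with hmL
    have h2 : limsup m l ≤ moment ν lam s (cut Ω L : Set (Site d)) E x y + ε L := by
      rw [← (h1.add (tendsto_const_nhds (x := ε L))).limsup_eq]
      refine limsup_le_limsup ?_
      filter_upwards [him, hdec] with z hz hzd
      exact (moment_cut_approx hν hs0 hsr hr1 hKtop hK hz hA hμ hzd hL hy).1
    have h3 : moment ν lam s (cut Ω L : Set (Site d)) E x y ≤ liminf m l + ε L := by
      rw [← tsub_le_iff_right]
      -- Continuity of truncated subtraction in `[0, ∞]` is justified here by the finiteness of `ε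
      -- L`.
      have h4 : Tendsto (fun z => mL z - ε L) l
          (𝓝 (moment ν lam s (cut Ω L : Set (Site d)) E x y - ε L)) := by
        refine ENNReal.Tendsto.sub h1 tendsto_const_nhds (.inr ?_)
        refine ENNReal.mul_ne_top (ENNReal.rpow_ne_top_of_nonneg ?_ (by simp))
          (ENNReal.rpow_ne_top_of_nonneg ?_ (ENNReal.mul_ne_top (by simp) hKtop))
        · exact div_nonneg (by linarith) (by linarith)
        · exact div_nonneg (by linarith) (by linarith)
      rw [← h4.liminf_eq]
      refine liminf_le_liminf ?_
      filter_upwards [him, hdec] with z hz hzd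
      rw [tsub_le_iff_right]
      exact (moment_cut_approx hν hs0 hsr hr1 hKtop hK hz hA hμ hzd hL hy).2
    calc _ ≤ _ := h2
      _ ≤ liminf m l + ε L + ε L := by gcongr
      _ = _ := add_assoc _ _ _
  have hε0 := tendsto_momentError d hs0 hsr A hμ (siteDist 0 y) hKtop
  have hle : limsup m l ≤ liminf m l := by
    have h := ge_of_tendsto ((tendsto_const_nhds (x := liminf m l)).add (hε0.add hε0)) hkey
    simpa using h
  have hlim : Tendsto m l (𝓝 (limsup m l)) :=
    tendsto_of_le_liminf_of_limsup_le hle le_rfl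
  refine ⟨_, hlim, le_of_tendsto hlim ?_⟩
  filter_upwards [him, hdec] with z hz hzd
  refine le_of_tendsto (tendsto_moment_cut hν hs0 hsr hKtop hK hz hx hy)
    (Eventually.of_forall fun L => hzd _ x y)

/-! ### The finite-volume criterion -/

theorem IsIIDPotential.criterion_eq {d : ℕ} {S : Type*} [MeasurableSpace S] {P : Measure S}
    [IsProbabilityMeasure P] {V : Site d → S → ℝ} {ν : Measure ℝ} (h : IsIIDPotential P V ν)
    (lam s C : ℝ) (Λ : Finset (Site d)) (z : ℂ) :
    criterion P V lam s C Λ z = Λ.powerset.sup fun W =>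
      ((boundaryBonds (fatten Λ)).card : ℝ≥0∞) * ENNReal.ofReal (C / lam ^ s) *
        ∑ b ∈ boundaryBonds Λ, moment ν lam s (W : Set (Site d)) z 0 b.1 := by
  simp only [criterion,
    h.greenMoment_eq lam s (measurable_enorm_green_rpow lam s _ z 0 _).aemeasurable]

theorem IsIIDPotential.tendsto_criterion {d : ℕ} {S : Type*} [MeasurableSpace S] {P : Measure S}
    [IsProbabilityMeasure P] {V : Site d → S → ℝ} {ν : Measure ℝ} [IsProbabilityMeasure ν]
    (h : IsIIDPotential P V ν) (hν : IsRegularLaw ν) {lam s r : ℝ} (hlam : lam ≠ 0) (hs0 : 0 < s)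
    (hsr : s < r) {K : ℝ≥0∞} (hKtop : K ≠ ∞) (hK : AprioriBound d ν lam r K) (C : ℝ)
    (Λ : Finset (Site d)) {E : ℂ} {l : Filter ℂ} [l.IsCountablyGenerated] [l.NeBot] (hl : l ≤ 𝓝 E)
    (him : ∀ᶠ z in l, z.im ≠ 0) :
    Tendsto (criterion P V lam s C Λ) l (𝓝 (criterion P V lam s C Λ E)) := by
  simp only [funext fun z => h.criterion_eq lam s C Λ z]
  refine Tendsto.finset_sup_nhds_apply fun W _ => ENNReal.Tendsto.const_mul ?_
    (.inr (ENNReal.mul_ne_top (by simp) (by simp)))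
  exact tendsto_finsetSum _ fun b _ =>
    tendsto_moment_energy hν hlam hs0 hsr hKtop hK W E hl him 0 b.1

theorem exists_siteDist_lt {d : ℕ} (T : Finset (Site d)) :
    ∃ ρ : ℝ, 0 < ρ ∧ ∀ a ∈ T, siteDist 0 a < ρ :=
  ⟨∑ a ∈ T, siteDist 0 a + 1,
    add_pos_of_nonneg_of_pos (Finset.sum_nonneg fun a _ => siteDist_nonneg 0 a) one_pos,
    fun _ ha => (Finset.single_le_sum (f := fun a => siteDist 0 a)
      (fun _ _ => siteDist_nonneg _ _) ha).trans_lt (lt_add_one _)⟩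

theorem eventually_im_ne_zero {E : ℂ} {l : Filter ℝ} (hl : l ≤ 𝓝[≠] 0) :
    ∀ᶠ η : ℝ in l, (E + Complex.I * η).im ≠ 0 := by
  have h1 : ∀ η : ℝ, (E + Complex.I * η).im = E.im + η := fun η => by simp
  simp only [h1]
  refine hl ?_
  by_cases hE : E.im = 0
  · simp only [hE, zero_add]
    exact self_mem_nhdsWithin
  · have hc : Tendsto (fun η : ℝ => E.im + η) (𝓝 0) (𝓝 (E.im + 0)) := by
      exact (continuous_const.add continuous_id).tendsto 0
    rw [add_zero] at hc
    exact nhdsWithin_le_nhds (hc.eventually_ne hE)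

end Anderson

theorem theorem2 (d : ℕ) (ν : Measure ℝ) [IsProbabilityMeasure ν] (hν : Anderson.IsRegularLaw ν)
    (s : ℝ) (hs0 : 0 < s) (hs1 : s < 1) :
    ∃ C : ℝ, 0 < C ∧
      ∀ (lam : ℝ), 0 < lam → ∀ (Λ : Finset (Anderson.Site d)), 0 ∈ Λ →
        ∃ μ A : ℝ≥0∞ → ℝ, (∀ b, 0 < μ b) ∧
          ∀ (S : Type*) [MeasurableSpace S] (P : Measure S) [IsProbabilityMeasure P]
            (V : Anderson.Site d → S → ℝ), Anderson.IsIIDPotential P V ν →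
            ∀ E : ℂ, Anderson.criterion P V lam s C Λ E < 1 →
              ∀ (Ω : Set (Anderson.Site d)), ∀ x ∈ Ω, ∀ y ∈ Ω, ∀ l ∈ ({𝓝[>] 0, 𝓝[<] 0} : Set (Filter ℝ)),
                Anderson.LimitMomentLE P V lam s Ω E x y l
                  (A (Anderson.criterion P V lam s C Λ E) *
                    Real.exp (-μ (Anderson.criterion P V lam s C Λ E) * Anderson.siteDist x y)) := by
  open Anderson in
  obtain ⟨C, hC0, hC⟩ := exists_aprioriBound d hν hs0 hs1
  -- The midpoint `(1+s)/2` is the auxiliary order `r` with `s < r < 1` used for uniform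
  -- integrability; its constant enters neither `μ` nor `A`.
  obtain ⟨C', -, hC'⟩ := exists_aprioriBound d hν (s := (1 + s) / 2) (by linarith) (by linarith)
  refine ⟨C, hC0, fun lam hlam Λ h0 => ?_⟩
  obtain ⟨ρ, hρ0, hρ⟩ := exists_siteDist_lt (fatten (fatten Λ))
  -- A rate strictly between `b` and 1: it leaves room for the criterion at energies near `E`, and
  -- is positive even when `b = 0`, so that its logarithm makes sense.
  set q : ℝ≥0∞ → ℝ := fun b => (1 + b.toReal) / 2 with hq
  -- The value 1 for `b ≥ 1` only keeps the rate positive for every argument.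
  refine ⟨fun b => if b < 1 then -Real.log (q b) / ρ else 1, fun b => C / lam ^ s / q b,
    fun b => ?_, ?_⟩
  · simp only
    split_ifs with hb
    · have hb' : b.toReal < 1 := by
        simpa using (ENNReal.toReal_lt_toReal hb.ne_top ENNReal.one_ne_top).2 hb
      refine div_pos (neg_pos.2 (Real.log_neg ?_ ?_)) hρ0
      · have := b.toReal_nonneg; simp only [hq]; linarith
      · simp only [hq]; linarith
    · exact one_pos
  intro S _ P _ V hV E hE Ω x hx y hy l hl
  set b := criterion P V lam s C Λ E with hb
  have hb1 : b.toReal < 1 := by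
    simpa using (ENNReal.toReal_lt_toReal hE.ne_top ENNReal.one_ne_top).2 hE
  have hb0 : 0 ≤ b.toReal := ENNReal.toReal_nonneg
  have hq0 : 0 < q b := by simp only [hq]; linarith
  have hq1 : q b < 1 := by simp only [hq]; linarith
  have hbq : b < ENNReal.ofReal (q b) := by
    rw [ENNReal.lt_ofReal_iff_toReal_lt hE.ne_top]
    simp only [hq]; linarith
  simp only [hE, if_true]
  have hμ : 0 < -Real.log (q b) / ρ := div_pos (neg_pos.2 (Real.log_neg hq0 hq1)) hρ0
  have hk : 0 ≤ C / lam ^ s := by positivity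
  have hl' : l.NeBot ∧ l.IsCountablyGenerated ∧ l ≤ 𝓝[≠] 0 := by
    rcases hl with rfl | rfl
    · exact ⟨inferInstance, inferInstance, nhdsWithin_mono _ fun t ht => ne_of_gt ht⟩
    · exact ⟨inferInstance, inferInstance, nhdsWithin_mono _ fun t ht => ne_of_lt ht⟩
  obtain ⟨_, _, hl0⟩ := hl'
  set φ : ℝ → ℂ := fun η => E + Complex.I * η with hφ
  have him := eventually_im_ne_zero (E := E) hl0
  have hφt : l.map φ ≤ 𝓝 E := by
    have h1 : Tendsto φ (𝓝 0) (𝓝 (φ 0)) :=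
      (by fun_prop : Continuous φ).tendsto 0
    have h2 : φ 0 = E := by simp [hφ]
    rw [h2] at h1
    exact h1.mono_left (hl0.trans nhdsWithin_le_nhds)
  have himφ : ∀ᶠ z in l.map φ, z.im ≠ 0 := him
  have hcrit := hV.tendsto_criterion hν hlam.ne' hs0 (by linarith) ENNReal.ofReal_ne_top
    (hC' lam hlam) C Λ hφt himφ
  have hdec : ∀ᶠ z in l.map φ, ExpDecay (d := d) ν lam s z (C / lam ^ s / q b)
      (-Real.log (q b) / ρ) := by
    -- The hypothesis concerns `E`, possibly real, whereas the iteration needs non-real `z`;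
    -- continuity of the criterion carries the bound over to `z` near `E`.
    filter_upwards [himφ, hcrit.eventually_lt_const hbq] with z hz hzq
    refine (hC lam hlam).expDecay hs0 hs1.le hk hz h0 hq0 hq1 (fun W hW => ?_) hρ hρ0
    rw [hV.criterion_eq] at hzq
    exact (Finset.le_sup (f := fun W : Finset (Site d) =>
      ((boundaryBonds (fatten Λ)).card : ℝ≥0∞) * ENNReal.ofReal (C / lam ^ s) *
        ∑ b ∈ boundaryBonds Λ, moment ν lam s (W : Set (Site d)) z 0 b.1)
      (Finset.mem_powerset.2 hW)).trans hzq.le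
  obtain ⟨M, hM, hMle⟩ := exists_tendsto_moment hν hlam.ne' hs0 (by linarith) (by linarith)
    ENNReal.ofReal_ne_top (hC' lam hlam) hφt himφ (by positivity) hμ hdec hx hy
  refine ⟨M, ?_, hMle⟩
  refine Tendsto.congr' ?_ (tendsto_map'_iff.1 hM)
  filter_upwards [him] with η hη
  exact (hV.greenMoment_eq lam s (aemeasurable_enorm_green_rpow hν lam s hη hx hy)).symm
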